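/- Let $K$ be a field and $A$ a finite-dimensional $K$-algebra with Jacobson radical $J$. Let the irreducible left $A$-modules $L(\lambda)$ be indexed (up to isomorphism, without repetition) by a poset $\Lambda$, with projective covers $P(\lambda)$ and injective hulls $I(\lambda)$. Let $\Delta(\lambda)$ be the largest quotient of $P(\lambda)$, and $\nabla(\lambda)$ the largest submodule of $I(\lambda)$, all of whose composition factors are of the form $L(\mu)$ with $\mu\le\lambda$. Assume that $A$ is quasi-hereditary: for every $\lambda$, $\operatorname{End}_A\Delta(\lambda)=K$, and the kernel of $P(\lambda)\to\Delta(\lambda)$ has a finite filtration with subquotients of the form $\Delta(\mu)$, $\mu>\lambda$. Filter $A$ by $J^iA=J^i$ for $i\ge 0$ and $J^iA=A$ for $i<0$, and assume that the Rees algebra $\mathrm{R}A=\bigoplus_{i\in\mathbb Z}(J^iA)t^i\subseteq A[t,t^{-1}]$, graded by powers of $t$, is graded quasi-hereditary with weight poset $\Lambda$: its graded irreducible modules are indexed by $\Lambda$ up to isomorphism and grading shift, they have graded projective covers, and the same two conditions hold in the category of graded modules (degree-$0$ homomorphisms), where composition factors and the subquotients $\Delta(\mu)$ are taken up to grading shift.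 For an $A$-module $M$ the radical filtration is $J^iM=\operatorname{rad}^iM=J^{\max(i,0)}M$, and the socle filtration has $\operatorname{soc}^iM$ in degree $-i$ for $i\ge0$ and $0$ in positive degrees. For a filtration $F^\bullet$ of $M$, a subquotient $M'/M''$ of $M$ carries the filtration $F^i(M'/M'')=((F^iM\cap M')+M'')/M''$; the shift of $F^\bullet$ by $s$ is $F^{i-s}$; an isomorphism of filtered modules carries $F^i$ onto $F^i$ for every $i$. Equip every $P(\lambda)$ with its radical filtration, and equip all the $I(\lambda)$ with their socle filtrations, or all of them with their radical filtrations (the statement holds for either convention, the convention being the same throughout); quotients of $P(\lambda)$ and submodules of $I(\lambda)$ carry the induced filtrations. Let $M$ be a filtered $A$-module. We say that $M$ has no stretched subquotients if, for all $\lambda<\mu$ in $\Lambda$: (a) every subquotient $M'/M''$ of $M$ which is a non-split extension $0\to L(\mu)\to M'/M''\to W\to 0$ with $W$ a quotient of $\Delta(\lambda)$ is isomorphic, as a filtered module, to a shift of a quotient of $P(\lambda)$; and (b) every subquotient $M'/M''$ of $M$ which is a non-split extension $0\to U\to M'/M''\to L(\mu)\to 0$ with $U$ a submodule of $\nabla(\lambda)$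 is isomorphic, as a filtered module, to a shift of a submodule of $I(\lambda)$. Let $T=T(\lambda)$ be the indecomposable tilting module of weight $\lambda$, that is, an indecomposable $A$-module which has a finite filtration with subquotients of the form $\Delta(\mu)$ and a finite filtration with subquotients of the form $\nabla(\mu)$, which has a unique submodule isomorphic to $\Delta(\lambda)$ and a unique quotient isomorphic to $\nabla(\lambda)$, and whose composition factors are of the form $L(\mu)$ with $\mu\le\lambda$. If $T$ has no stretched subquotients when $T$ carries its radical filtration, and none when $T$ carries its socle filtration, then $T$ is rigid: for some $n$ (the Loewy length of $T$), $\operatorname{rad}^iT=\operatorname{soc}^{n-i}T$ for all $0\le i\le n$. -/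

import Mathlib

universe u v w x

/-! ## Families of additive subgroups indexed by the integers

Filtrations and gradings of a module are both given by a family of additive subgroups indexed by
`ℤ`, and sub-, quotient and shifted structures are formed by the same recipes. -/

section Families

/-- A family of additive subgroups of `M` indexed by the integers. -/
abbrev ZFamily (M : Type*) [AddCommGroup M] := ℤ → AddSubgroup M

namespace ZFamily

variable {R : Type*} [Ring R]
variable {M : Type*} [AddCommGroup M] [Module R M]
variable {N : Type*} [AddCommGroup N] [Module R N]

/-- The shift by `s`: `F⟨s⟩ⁱ = Fⁱ⁻ˢ`. -/
def shift (F : ZFamily M) (s : ℤ) : ZFamily M := fun i => F (i - s)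

/-- The family induced on a submodule `N`: `Fⁱ N = Fⁱ ∩ N`. -/
def sub (F : ZFamily M) (N : Submodule R M) : ZFamily N :=
  fun i => (F i).comap N.subtype.toAddMonoidHom

/-- The family induced on a quotient: `Fⁱ (M / N) = (Fⁱ + N) / N`. -/
def quot (F : ZFamily M) (N : Submodule R M) : ZFamily (M ⧸ N) :=
  fun i => (F i).map N.mkQ.toAddMonoidHom

/-- The family induced on the subquotient `M₁ / M₂` (for `M₂ ≤ M₁`). -/
def subquot (F : ZFamily M) (M₁ M₂ : Submodule R M) : ZFamily (M₁ ⧸ M₂.submoduleOf M₁) :=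
  (F.sub M₁).quot (M₂.submoduleOf M₁)

/-- Isomorphism of modules with families: an isomorphism of modules that carries `Fⁱ` onto `Gⁱ`
for all `i`. -/
def Iso (R : Type*) [Ring R] {M N : Type*} [AddCommGroup M] [Module R M]
    [AddCommGroup N] [Module R N] (F : ZFamily M) (G : ZFamily N) : Prop :=
  ∃ e : M ≃ₗ[R] N, ∀ i, (F i).map e.toLinearMap.toAddMonoidHom = G i

end ZFamily

end Families

/-! ## Radical and socle series -/

section Loewy

variable (A : Type u) [Ring A] (M : Type*) [AddCommGroup M] [Module A M]

/-- `radⁿ M = J(A)ⁿ M`. -/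
def radSeries (n : ℕ) : Submodule A M := (Ring.jacobson A) ^ n • (⊤ : Submodule A M)

/-- The socle: the sum of all simple submodules. -/
def moduleSocle : Submodule A M := sSup {N : Submodule A M | IsSimpleModule A N}

/-- `soc⁰ M = 0` and `socⁿ⁺¹ M / socⁿ M` is the socle of `M / socⁿ M`. -/
def socSeries : ℕ → Submodule A M
  | 0 => ⊥
  | n + 1 => (moduleSocle A (M ⧸ socSeries n)).comap (socSeries n).mkQ

/-- The radical filtration: `Jⁱ M = radⁱ M` for `i ≥ 0` and `Jⁱ M = M` for `i < 0`. -/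
def radicalFiltration : ZFamily M := fun i => (radSeries A M i.toNat).toAddSubgroup

/-- The socle filtration: degree `-i` is `socⁱ M` for `i ≥ 0` and is `0` for `i < 0`. -/
def socleFiltration : ZFamily M := fun i => (socSeries A M (-i).toNat).toAddSubgroup

/-- `M` is rigid: its radical series `M = rad⁰ M ≥ rad¹ M ≥ ⋯ ≥ radⁿ M = 0` and its socle series
`0 = soc⁰ M ≤ soc¹ M ≤ ⋯ ≤ socⁿ M = M` coincide. (For `M ≠ 0` such an `n` is necessarily the Loewy
length.) -/
def IsRigidModule : Prop :=
  ∃ n : ℕ, ∀ i ≤ n, radSeries A M i = socSeries A M (n - i)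

/-- The two standard filtrations of a module. -/
inductive LoewyKind
  | radical
  | socle

/-- The filtration of the given kind. -/
def loewyFiltration (A : Type u) [Ring A] (κ : LoewyKind) (M : Type*) [AddCommGroup M]
    [Module A M] : ZFamily M :=
  match κ with
  | .radical => radicalFiltration A M
  | .socle => socleFiltration A M

end Loewy

/-! ## Modules -/

section Modules

variable {A : Type u} [Ring A]

/-- `f : P → M` is a projective cover: `P` is projective and `f` is surjective with superfluous
kernel. -/
def IsProjectiveCover {P M : Type*} [AddCommGroup P] [Module A P] [AddCommGroup M] [Module A M]
    (f : P →ₗ[A] M) : Prop :=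
  Module.Projective A P ∧ Function.Surjective f ∧
    ∀ N : Submodule A P, N ⊔ LinearMap.ker f = ⊤ → N = ⊤

/-- `f : M → I` is an injective hull: `I` is injective and `f` is injective with essential
image. -/
def IsInjectiveHull {M I : Type*} [AddCommGroup M] [Module A M] [AddCommGroup I] [Module A I]
    (f : M →ₗ[A] I) : Prop :=
  Module.Injective A I ∧ Function.Injective f ∧
    ∀ N : Submodule A I, N ⊓ LinearMap.range f = ⊥ → N = ⊥

/-- `E` is a non-trivial (non-split) extension of `W` by `S`: there is a non-split short exact
sequence `0 → S → E → W → 0`. -/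
def IsNontrivialExtension (A : Type u) [Ring A] (W S E : Type*) [AddCommGroup W] [Module A W]
    [AddCommGroup S] [Module A S] [AddCommGroup E] [Module A E] : Prop :=
  ∃ (f : S →ₗ[A] E) (g : E →ₗ[A] W), Function.Injective f ∧ Function.Surjective g ∧
    LinearMap.range f = LinearMap.ker g ∧ ¬ ∃ s : W →ₗ[A] E, g ∘ₗ s = LinearMap.id

/-- `M` is non-zero and is not the direct sum of two non-zero submodules. -/
def IsIndecomposableModule (A : Type u) [Ring A] (M : Type*) [AddCommGroup M] [Module A M] :
    Prop :=
  Nontrivial M ∧ ∀ N₁ N₂ : Submodule A M, IsCompl N₁ N₂ → N₁ = ⊥ ∨ N₂ = ⊥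

/-- `M` has a finite series of submodules `0 = C₀ ≤ C₁ ≤ ⋯ ≤ Cₙ = M` with each `Cₖ₊₁ / Cₖ`
isomorphic to `D μ` for some `μ ∈ s`. -/
def HasModuleFiltration (A : Type u) [Ring A] {Λ : Type*} (D : Λ → Type*)
    [∀ l, AddCommGroup (D l)] [∀ l, Module A (D l)] (s : Set Λ)
    (M : Type*) [AddCommGroup M] [Module A M] : Prop :=
  ∃ (n : ℕ) (C : ℕ → Submodule A M), Monotone C ∧ C 0 = ⊥ ∧ C n = ⊤ ∧
    ∀ k < n, ∃ m ∈ s, Nonempty ((C (k + 1) ⧸ (C k).submoduleOf (C (k + 1))) ≃ₗ[A] D m)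

end Modules

/-! ## Quasi-hereditary algebras -/

/-- An indexing by `Λ` of the irreducible `A`-modules `L λ` (up to isomorphism, without
repetition), together with the projective cover `P λ` and the injective hull `I λ` of each. -/
structure SimpleIndexing (A : Type u) [Ring A] (Λ : Type x) where
  L : Λ → ModuleCat.{u} A
  P : Λ → ModuleCat.{u} A
  I : Λ → ModuleCat.{u} A
  cover : ∀ l, P l →ₗ[A] L l
  hull : ∀ l, L l →ₗ[A] I l
  simple : ∀ l, IsSimpleModule A (L l)
  eq_of_iso : ∀ l m, Nonempty (L l ≃ₗ[A] L m) → l = m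
  exists_iso : ∀ S : ModuleCat.{u} A, IsSimpleModule A S → ∃ l, Nonempty (S ≃ₗ[A] L l)
  isProjectiveCover : ∀ l, IsProjectiveCover (cover l)
  isInjectiveHull : ∀ l, IsInjectiveHull (hull l)

namespace SimpleIndexing

variable {A : Type u} [Ring A] {Λ : Type x} [PartialOrder Λ] (X : SimpleIndexing A Λ)

/-- All composition factors (simple subquotients) of `M` are among the `L μ` with `μ ≤ l`. -/
def FactorsLE (l : Λ) (M : Type*) [AddCommGroup M] [Module A M] : Prop :=
  ∀ M₁ M₂ : Submodule A M, M₂ ≤ M₁ → IsSimpleModule A (M₁ ⧸ M₂.submoduleOf M₁) →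
    ∃ m ≤ l, Nonempty ((M₁ ⧸ M₂.submoduleOf M₁) ≃ₗ[A] X.L m)

/-- The kernel of `P l → Δ l`: the smallest submodule `N` such that all composition factors of
`P l / N` are among the `L μ` with `μ ≤ l`. -/
def standardKernel (l : Λ) : Submodule A (X.P l) :=
  sInf {N | X.FactorsLE l (X.P l ⧸ N)}

/-- The standard (Weyl) module `Δ l`. -/
abbrev Standard (l : Λ) : Type u := X.P l ⧸ X.standardKernel l

/-- The costandard (good) module `∇ l`: the largest submodule of `I l` all of whose composition
factors are among the `L μ` with `μ ≤ l`. -/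
def costandard (l : Λ) : Submodule A (X.I l) :=
  sSup {N | X.FactorsLE l N}

/-- `A` is a quasi-hereditary `K`-algebra with respect to the partial order on `Λ`: for all `l`,
`End (Δ l) = K`, and `P l` has a `Δ`-filtration, in which `Δ l` is the top quotient and the other
subquotients are of the form `Δ μ` with `μ > l`. -/
def IsQuasiHereditary (K : Type v) [Field K] [Algebra K A] : Prop :=
  ∀ l,
    (∀ f : X.Standard l →ₗ[A] X.Standard l, ∃ c : K, ∀ y, f y = algebraMap K A c • y) ∧
    HasModuleFiltration A (fun m => X.Standard m) {m | l < m} (X.standardKernel l)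

/-- `T` is the indecomposable tilting module `T(l)`. -/
structure IsIndecomposableTilting (l : Λ) (T : Type*) [AddCommGroup T] [Module A T] : Prop where
  indecomposable : IsIndecomposableModule A T
  standard_filtration : HasModuleFiltration A (fun m => X.Standard m) Set.univ T
  costandard_filtration : HasModuleFiltration A (fun m => X.costandard m) Set.univ T
  unique_standard_sub : ∃! N : Submodule A T, Nonempty (N ≃ₗ[A] X.Standard l)
  unique_costandard_quot : ∃! N : Submodule A T, Nonempty ((T ⧸ N) ≃ₗ[A] X.costandard l)
  factors_le : X.FactorsLE l T

section Stretched

variable {E : Type*} [AddCommGroup E] [Module A E]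

/-- `E` is a non-trivial extension of `W` by `L m` for some quotient `W` of `Δ l`, and `l < m`. -/
def IsWeylIrreducible (l m : Λ) (E : Type*) [AddCommGroup E] [Module A E] : Prop :=
  l < m ∧ ∃ N : Submodule A (X.Standard l),
    IsNontrivialExtension A (X.Standard l ⧸ N) (X.L m) E

/-- `E` is a non-trivial extension of `L m` by `U` for some submodule `U` of `∇ l`, and `l < m`. -/
def IsIrreducibleGood (l m : Λ) (E : Type*) [AddCommGroup E] [Module A E] : Prop :=
  l < m ∧ ∃ U : Submodule A (X.costandard l), IsNontrivialExtension A (X.L m) U E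

/-- `E`, filtered by `F`, is isomorphic as a filtered module to a shifted quotient of `P l`, where
`P l` carries its radical filtration. -/
def IsShiftedQuotient (l : Λ) (F : ZFamily E) : Prop :=
  ∃ (N : Submodule A (X.P l)) (s : ℤ),
    F.Iso A (((radicalFiltration A (X.P l)).quot N).shift s)

/-- `E`, filtered by `F`, is isomorphic as a filtered module to a shifted submodule of `I l`, where
`I l` carries its filtration of kind `κ`. -/
def IsShiftedSubmodule (κ : LoewyKind) (l : Λ) (F : ZFamily E) : Prop :=
  ∃ (N : Submodule A (X.I l)) (s : ℤ),
    F.Iso A (((loewyFiltration A κ (X.I l)).sub N).shift s)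

/-- `T`, filtered by `F`, has no stretched subquotients: every Weyl-irreducible subquotient is a
shifted quotient of the corresponding `P l`, and every irreducible-good subquotient is a shifted
submodule of the corresponding `I l`, as filtered modules. -/
def NoStretchedSubquotients (κ : LoewyKind) {T : Type*} [AddCommGroup T] [Module A T]
    (F : ZFamily T) : Prop :=
  ∀ T₁ T₂ : Submodule A T, T₂ ≤ T₁ → ∀ l m : Λ,
    (X.IsWeylIrreducible l m (T₁ ⧸ T₂.submoduleOf T₁) →
      X.IsShiftedQuotient l (F.subquot T₁ T₂)) ∧
    (X.IsIrreducibleGood l m (T₁ ⧸ T₂.submoduleOf T₁) →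
      X.IsShiftedSubmodule κ l (F.subquot T₁ T₂))

end Stretched

end SimpleIndexing

/-! ## Filtered algebras and the Rees algebra -/

/-- A generalized filtration on a `K`-algebra `A`. -/
structure AlgFiltration (K : Type v) (A : Type u) [Field K] [Ring A] [Algebra K A] where
  F : ℤ → Submodule K A
  span_eq_top : ⨆ i, F i = ⊤
  one_mem : (1 : A) ∈ F 0
  mul_mem : ∀ i j a b, a ∈ F i → b ∈ F j → a * b ∈ F (i + j)

/-- The radical filtration on `A`: `Jⁱ A = J(A)ⁱ` for `i ≥ 0` and `Jⁱ A = A` for `i < 0`. -/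
def AlgFiltration.radical (K : Type v) (A : Type u) [Field K] [Ring A] [Algebra K A] :
    AlgFiltration K A where
  F i := ((Ring.jacobson A) ^ i.toNat).restrictScalars K
  span_eq_top := by
    refine top_le_iff.mp (le_trans ?_ (le_iSup _ (0 : ℤ)))
    intro a _
    simp [Submodule.pow_zero, Ideal.one_eq_top]
  one_mem := by simp [Submodule.pow_zero, Ideal.one_eq_top]
  mul_mem := by
    intro i j a b ha hb
    simp only [Submodule.restrictScalars_mem] at ha hb ⊢
    have h1 : a * b ∈ Ring.jacobson A ^ (i.toNat + j.toNat) := by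
      rw [Ideal.IsTwoSided.pow_add]
      exact Ideal.mul_mem_mul ha hb
    exact Ideal.pow_le_pow_right (by omega) h1

namespace AlgFiltration

variable {K : Type v} {A : Type u} [Field K] [Ring A] [Algebra K A] (𝓕 : AlgFiltration K A)

/-- The Rees algebra `⨁ᵢ (Fⁱ A) tⁱ`, a subalgebra of `A[t, t⁻¹]`. -/
def rees : Subalgebra K (LaurentPolynomial A) where
  carrier := {f | ∀ i, f.coeff i ∈ 𝓕.F i}
  mul_mem' := by
    intro f g hf hg i
    rw [AddMonoidAlgebra.coeff_mul]
    refine Submodule.sum_mem _ fun j _ => Submodule.sum_mem _ fun k _ => ?_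
    beta_reduce
    split_ifs with h
    · exact h ▸ 𝓕.mul_mem j k _ _ (hf j) (hg k)
    · exact Submodule.zero_mem _
  add_mem' := by
    intro f g hf hg i
    exact Submodule.add_mem _ (hf i) (hg i)
  algebraMap_mem' := by
    intro c i
    rw [Algebra.algebraMap_eq_smul_one, AddMonoidAlgebra.coeff_smul_apply]
    refine Submodule.smul_mem _ c ?_
    rw [AddMonoidAlgebra.one_def, AddMonoidAlgebra.coeff_single, Finsupp.single_apply]
    split_ifs with h
    · exact h ▸ 𝓕.one_mem
    · exact Submodule.zero_mem _

/-- The grading on the Rees algebra: degree `i` is `(Fⁱ A) tⁱ`. -/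
def reesGrading : ZFamily 𝓕.rees := fun i =>
  { carrier := {f | ∀ j, j ≠ i → f.1.coeff j = 0}
    zero_mem' := fun _ _ => rfl
    add_mem' := by
      intro f g hf hg j hj
      have h : (f + g).1.coeff j = f.1.coeff j + g.1.coeff j := rfl
      rw [h, hf j hj, hg j hj, add_zero]
    neg_mem' := by
      intro f hf j hj
      have h : (-f).1.coeff j = -f.1.coeff j := rfl
      rw [h, hf j hj, neg_zero] }

end AlgFiltration

/-! ## Graded modules and graded quasi-hereditary algebras -/

/-- A graded module over the graded ring `B = ⨁ᵢ 𝓑 i`. -/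
structure GradedMod {B : Type u} [Ring B] (𝓑 : ZFamily B) where
  carrier : ModuleCat.{u} B
  deg : ZFamily carrier
  isInternal : DirectSum.IsInternal deg
  smul_mem : ∀ i j (b : B) (y : carrier), b ∈ 𝓑 i → y ∈ deg j → b • y ∈ deg (i + j)

section Graded

variable {B : Type u} [Ring B]

/-- A submodule generated by homogeneous elements, i.e. a graded submodule. -/
def IsGradedSubmodule {M : Type*} [AddCommGroup M] [Module B M] (G : ZFamily M)
    (N : Submodule B M) : Prop :=
  N.toAddSubgroup ≤ ⨆ i, N.toAddSubgroup ⊓ G i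

/-- A non-zero graded module without proper non-zero graded submodules. -/
def IsGradedSimple (B : Type u) [Ring B] {M : Type*} [AddCommGroup M] [Module B M]
    (G : ZFamily M) : Prop :=
  Nontrivial M ∧ ∀ N : Submodule B M, IsGradedSubmodule G N → N = ⊥ ∨ N = ⊤

end Graded

/-- An indexing by `Λ` of the graded irreducible `B`-modules `L λ` (up to isomorphism and grading
shift, without repetition), together with the graded projective cover `P λ` of each. (A graded
module is projective as a graded module if and only if it is projective as a module.) -/
structure GradedSimpleIndexing {B : Type u} [Ring B] (𝓑 : ZFamily B) (Λ : Type x) where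
  L : Λ → GradedMod 𝓑
  P : Λ → GradedMod 𝓑
  cover : ∀ l, (P l).carrier →ₗ[B] (L l).carrier
  simple : ∀ l, IsGradedSimple B (L l).deg
  eq_of_iso : ∀ l m s, ZFamily.Iso B (L l).deg ((L m).deg.shift s) → l = m
  exists_iso : ∀ S : GradedMod 𝓑, IsGradedSimple B S.deg →
    ∃ l s, ZFamily.Iso B S.deg ((L l).deg.shift s)
  projective : ∀ l, Module.Projective B (P l).carrier
  cover_deg : ∀ l i, ((P l).deg i).map (cover l).toAddMonoidHom ≤ (L l).deg i
  cover_surjective : ∀ l, Function.Surjective (cover l)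
  cover_superfluous : ∀ l (N : Submodule B (P l).carrier), IsGradedSubmodule (P l).deg N →
    N ⊔ LinearMap.ker (cover l) = ⊤ → N = ⊤

namespace GradedSimpleIndexing

variable {B : Type u} [Ring B] {𝓑 : ZFamily B} {Λ : Type x} [PartialOrder Λ]
  (X : GradedSimpleIndexing 𝓑 Λ)

/-- All graded composition factors (graded simple subquotients) are shifts of the `L μ` with
`μ ≤ l`. -/
def FactorsLE (l : Λ) {M : Type*} [AddCommGroup M] [Module B M] (G : ZFamily M) : Prop :=
  ∀ M₁ M₂ : Submodule B M, M₂ ≤ M₁ → IsGradedSubmodule G M₁ → IsGradedSubmodule G M₂ →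
    IsGradedSimple B (G.subquot M₁ M₂) →
    ∃ m ≤ l, ∃ s, ZFamily.Iso B (G.subquot M₁ M₂) ((X.L m).deg.shift s)

/-- The kernel of `P l → Δ l`: the smallest graded submodule `N` such that all graded composition
factors of `P l / N` are shifts of the `L μ` with `μ ≤ l`. -/
def standardKernel (l : Λ) : Submodule B (X.P l).carrier :=
  sInf {N | IsGradedSubmodule (X.P l).deg N ∧ X.FactorsLE l ((X.P l).deg.quot N)}

/-- The graded standard module `Δ l`. -/
abbrev Standard (l : Λ) : Type u := (X.P l).carrier ⧸ X.standardKernel l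

/-- The grading of `Δ l`. -/
def standardDeg (l : Λ) : ZFamily (X.Standard l) := (X.P l).deg.quot (X.standardKernel l)

/-- The graded quasi-hereditary condition: for all `l`, the graded endomorphisms (of degree `0`) of
`Δ l` are the scalars, and `P l` has a finite series of graded submodules with top quotient `Δ l`
whose other subquotients are shifts of `Δ μ` with `μ > l`. -/
def IsQuasiHereditary (K : Type v) [Field K] [Algebra K B] : Prop :=
  ∀ l,
    (∀ f : X.Standard l →ₗ[B] X.Standard l,
      (∀ i, (X.standardDeg l i).map f.toAddMonoidHom ≤ X.standardDeg l i) →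
        ∃ c : K, ∀ y, f y = algebraMap K B c • y) ∧
    ∃ (n : ℕ) (C : ℕ → Submodule B (X.P l).carrier), Monotone C ∧
      (∀ k, IsGradedSubmodule (X.P l).deg (C k)) ∧ C 0 = ⊥ ∧ C n = X.standardKernel l ∧
      ∀ k < n, ∃ m, l < m ∧ ∃ s,
        ZFamily.Iso B ((X.P l).deg.subquot (C (k + 1)) (C k)) ((X.standardDeg m).shift s)

end GradedSimpleIndexing

/-- The graded `K`-algebra `B = ⨁ᵢ 𝓑 i` is graded quasi-hereditary with weight poset `Λ`. -/
def IsGradedQuasiHereditary (K : Type v) [Field K] {B : Type u} [Ring B] [Algebra K B]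
    (𝓑 : ZFamily B) (Λ : Type x) [PartialOrder Λ] : Prop :=
  ∃ X : GradedSimpleIndexing 𝓑 Λ, X.IsQuasiHereditary K

/-! ## Lifting maps to and from simple modules -/

/-! The radical and socle filtrations of the tilting module are compared as two filtrations `G₁`,
`G₂`. On each Weyl-irreducible or irreducible-good subquotient both have the shape of a shifted
quotient of `P l`, or submodule of `I l`. A comparison of two such shapes lifts to an endomorphism
of `P l` (or extends to one of `I l`), and linear maps respect the standard filtrations, so `G₁` and
`G₂` agree there up to a shift (`IsShiftedQuotient.exists_shift`,
`IsShiftedSubmodule.exists_shift`).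

Local agreement is spread over all of `T` in `IsIndecomposableTilting.filtration_le`. Call `m` bad
if some `f : P m → T` lands in `G₁ i` but not in `G₂ i`; if `G₁ ≤ G₂` fails, a bad weight exists,
and one takes a maximal one. If `f` does not kill the kernel of `P m → Δ m`, the image of that
kernel has a simple quotient `L m'` with `m' > m`, and agreement on a Weyl-irreducible quotient of
the image of `f` carries the lead of `G₁` from its top to `L m'`, so `m'` is bad
(`exists_lt_of_weylIrreducible`). Otherwise `f` factors through `Δ m`; choose `h : T → I m` killing
`G₂ i` with `h ∘ f ≠ 0`. If `h` leaves `∇ m`, the dual argument climbs again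
(`exists_lt_of_irreducibleGood`). If not, `Δ m → T → ∇ m` is non-zero, which for an indecomposable
tilting module happens only at its own weight (`IsIndecomposableTilting.eq_of_comp_ne_zero`).

At that weight `Hom(P l, T)` is a line (`IsIndecomposableTilting.exists_forall_eq_smul`), so one
overall shift makes `l` not bad in either direction. The two filtrations then coincide up to this
shift, which is rigidity. -/

theorem Submodule.mem_submoduleOf_iff {R : Type*} [Ring R] {M : Type*} [AddCommGroup M]
    [Module R M] {N₁ N₂ : Submodule R M} {y : N₂} : y ∈ N₁.submoduleOf N₂ ↔ (y : M) ∈ N₁ :=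
  Iff.rfl

namespace SimpleIndexing

section Basic

variable {A : Type u} [Ring A] {Λ : Type x} (X : SimpleIndexing A Λ)

/-- The indexing only mentions simple modules in universe `u`. Every simple module is a quotient of
`A` by a maximal left ideal, which removes that restriction. -/
theorem exists_linearEquiv_L (S : Type*) [AddCommGroup S] [Module A S] [IsSimpleModule A S] :
    ∃ l, Nonempty (S ≃ₗ[A] X.L l) := by
  obtain ⟨I, hI, ⟨e⟩⟩ := isSimpleModule_iff_quot_maximal.mp (inferInstance : IsSimpleModule A S)
  have h : IsSimpleModule A (ModuleCat.of A (A ⧸ I)) := IsSimpleModule.congr e.symm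
  obtain ⟨l, ⟨e'⟩⟩ := X.exists_iso (ModuleCat.of A (A ⧸ I)) h
  exact ⟨l, ⟨e.trans e'⟩⟩

instance simple_L (l : Λ) : IsSimpleModule A (X.L l) := X.simple l

instance projective_P (l : Λ) : Module.Projective A (X.P l) := (X.isProjectiveCover l).1

theorem cover_surjective (l : Λ) : Function.Surjective (X.cover l) := (X.isProjectiveCover l).2.1

theorem isCoatom_ker_cover (l : Λ) : IsCoatom (LinearMap.ker (X.cover l)) :=
  LinearMap.isCoatom_ker_of_surjective (X.cover_surjective l)

/-- A submodule not below the maximal submodule `ker (cover l)` sums with it to `P l`, and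
superfluousness makes it everything. So `P l` is local, and in particular cyclic. -/
theorem le_ker_cover {l : Λ} {N : Submodule A (X.P l)} (hN : N ≠ ⊤) :
    N ≤ LinearMap.ker (X.cover l) := by
  by_contra h
  refine hN ((X.isProjectiveCover l).2.2 N ?_)
  exact (X.isCoatom_ker_cover l).2 _ (lt_of_le_of_ne le_sup_right fun h' =>
    h (by rw [h']; exact le_sup_left))

theorem ker_le_ker_cover {l : Λ} {M : Type*} [AddCommGroup M] [Module A M] {f : X.P l →ₗ[A] M}
    (hf : f ≠ 0) : LinearMap.ker f ≤ LinearMap.ker (X.cover l) :=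
  X.le_ker_cover fun h => hf (LinearMap.ker_eq_top.mp h)

theorem exists_span_eq_top (l : Λ) : ∃ y : X.P l, Submodule.span A {y} = ⊤ := by
  have := IsSimpleModule.nontrivial A (X.L l)
  obtain ⟨z, hz⟩ := exists_ne (0 : X.L l)
  obtain ⟨y, rfl⟩ := X.cover_surjective l z
  refine ⟨y, ?_⟩
  by_contra h
  exact hz (X.le_ker_cover h (Submodule.mem_span_singleton_self y))

instance finite_P (l : Λ) : Module.Finite A (X.P l) := by
  obtain ⟨y, hy⟩ := X.exists_span_eq_top l
  exact ⟨⟨{y}, by simpa using hy⟩⟩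

/-- A non-zero map to a simple module is hit by some projective cover. -/
theorem exists_hom_comp_ne_zero {M S : Type*} [AddCommGroup M] [Module A M] [AddCommGroup S]
    [Module A S] {l : Λ} (e : S ≃ₗ[A] X.L l) (g : M →ₗ[A] S)
    (hg : g ≠ 0) : ∃ f : X.P l →ₗ[A] M, g ∘ₗ f = e.symm.toLinearMap ∘ₗ X.cover l := by
  have : IsSimpleModule A S := IsSimpleModule.congr e
  exact Module.projective_lifting_property g _ (LinearMap.surjective_of_ne_zero hg)

theorem symm_comp_cover_surjective {S : Type*} [AddCommGroup S]
    [Module A S] {l : Λ} (e : S ≃ₗ[A] X.L l) :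
    Function.Surjective (e.symm.toLinearMap ∘ₗ X.cover l) := by
  simpa using X.cover_surjective l

/-- The only simple quotient of `P l` is `L l`. -/
theorem eq_of_hom_ne_zero {l m : Λ} {S : Type*} [AddCommGroup S] [Module A S]
    (e : S ≃ₗ[A] X.L m) (f : X.P l →ₗ[A] S) (hf : f ≠ 0) : l = m := by
  have : IsSimpleModule A S := IsSimpleModule.congr e
  have hs := LinearMap.surjective_of_ne_zero hf
  have h1 : LinearMap.ker f = LinearMap.ker (X.cover l) :=
    (((LinearMap.isCoatom_ker_of_surjective hs).le_iff).mp (X.ker_le_ker_cover hf)).resolve_left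
      (X.isCoatom_ker_cover l).1 |>.symm
  exact X.eq_of_iso l m ⟨((LinearMap.quotKerEquivOfSurjective _ (X.cover_surjective l)).symm.trans
    (Submodule.quotEquivOfEq _ _ h1.symm)).trans
      ((LinearMap.quotKerEquivOfSurjective _ hs).trans e)⟩

/-- Submodules are detected by maps from the `P m`. -/
theorem exists_range_le_not_le {M : Type*} [AddCommGroup M] [Module A M]
    {M₁ N : Submodule A M} (h : ¬ M₁ ≤ N) :
    ∃ m, ∃ f : X.P m →ₗ[A] M, LinearMap.range f ≤ M₁ ∧ ¬ LinearMap.range f ≤ N := by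
  obtain ⟨z, hz, hzN⟩ := Set.not_subset.mp h
  -- A cyclic submodule has maximal submodules above any proper one, so no finiteness of `M` is
  -- needed.
  set Z := Submodule.span A {z}
  have hZ : Module.Finite A Z := Module.Finite.span_singleton A z
  have hN : N.comap Z.subtype ≠ ⊤ := fun hN => hzN <| by
    have : (⟨z, Submodule.mem_span_singleton_self z⟩ : Z) ∈ N.comap Z.subtype := hN ▸ trivial
    exact this
  obtain ⟨Q, hQ, hNQ⟩ := (eq_top_or_exists_le_coatom (N.comap Z.subtype)).resolve_left hN
  have : IsSimpleModule A (Z ⧸ Q) := isSimpleModule_iff_isCoatom.mpr hQ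
  obtain ⟨m, ⟨e⟩⟩ := X.exists_linearEquiv_L (Z ⧸ Q)
  obtain ⟨f, hf⟩ := X.exists_hom_comp_ne_zero e Q.mkQ (fun h0 => hQ.1 (by
    rw [← Q.ker_mkQ, h0, LinearMap.ker_zero]))
  refine ⟨m, Z.subtype ∘ₗ f, ?_, ?_⟩
  · rintro _ ⟨y, rfl⟩
    exact (Submodule.span_le.mpr (Set.singleton_subset_iff.mpr hz)) (f y).2
  · intro hle
    have h2 : ∀ y, f y ∈ Q := fun y => hNQ (hle ⟨y, rfl⟩)
    refine hQ.1 (eq_top_iff.mpr fun q _ => ?_)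
    obtain ⟨y, hy⟩ := X.symm_comp_cover_surjective e (Q.mkQ q)
    rw [← hf, LinearMap.comp_apply, Q.mkQ_apply, (Submodule.Quotient.mk_eq_zero Q).mpr (h2 y)] at hy
    exact (Submodule.Quotient.mk_eq_zero Q).mp hy.symm

variable [PartialOrder Λ]

/-- `M` has all composition factors `≤ l` iff `Hom(P m, M) ≠ 0` only for `m ≤ l`. -/
theorem factorsLE_iff {l : Λ} {M : Type*} [AddCommGroup M] [Module A M] :
    X.FactorsLE l M ↔ ∀ m, ∀ f : X.P m →ₗ[A] M, f ≠ 0 → m ≤ l := by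
  constructor
  · intro h m f hf
    -- Since `P m` is local, `R` modulo the image `R'` of its maximal submodule is a copy of `L m`:
    -- the composition factor to test.
    let R := LinearMap.range f
    let R' := (LinearMap.ker (X.cover m)).map f
    have hle : R' ≤ R := LinearMap.map_le_range
    let g : X.P m →ₗ[A] R ⧸ R'.submoduleOf R := (R'.submoduleOf R).mkQ ∘ₗ f.rangeRestrict
    have hg : Function.Surjective g :=
      (Submodule.mkQ_surjective _).comp f.surjective_rangeRestrict
    have hker : LinearMap.ker g = LinearMap.ker (X.cover m) := by
      ext y
      simp only [g, LinearMap.mem_ker, LinearMap.comp_apply, Submodule.mkQ_apply,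
        Submodule.Quotient.mk_eq_zero, Submodule.mem_submoduleOf_iff]
      constructor
      · rintro ⟨z, hz, hzy⟩
        have : y - z ∈ LinearMap.ker (X.cover m) := X.ker_le_ker_cover hf (by
          rw [LinearMap.mem_ker, map_sub, hzy]; simp)
        have := Submodule.add_mem _ this hz
        rwa [sub_add_cancel] at this
      · exact fun hy => ⟨y, hy, rfl⟩
    have e : (R ⧸ R'.submoduleOf R) ≃ₗ[A] X.L m :=
      ((LinearMap.quotKerEquivOfSurjective g hg).symm.trans
        (Submodule.quotEquivOfEq _ _ hker)).trans
        (LinearMap.quotKerEquivOfSurjective _ (X.cover_surjective m))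
    obtain ⟨k, hk, ⟨e'⟩⟩ := h R R' hle (IsSimpleModule.congr e)
    rwa [X.eq_of_iso m k ⟨e.symm.trans e'⟩]
  · intro h M₁ M₂ hle hS
    obtain ⟨m, ⟨e⟩⟩ := X.exists_linearEquiv_L (M₁ ⧸ M₂.submoduleOf M₁)
    refine ⟨m, ?_, ⟨e⟩⟩
    have hS' := (isSimpleModule_iff_isCoatom.mp hS)
    obtain ⟨f, hf⟩ := X.exists_hom_comp_ne_zero e (M₂.submoduleOf M₁).mkQ (fun h0 => hS'.1 (by
      rw [← (M₂.submoduleOf M₁).ker_mkQ, h0, LinearMap.ker_zero]))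
    refine h m (M₁.subtype ∘ₗ f) fun h0 => ?_
    have hf0 : f = 0 := by
      ext y
      exact congrArg (fun q : X.P m →ₗ[A] M => q y) h0
    have := IsSimpleModule.nontrivial A (M₁ ⧸ M₂.submoduleOf M₁)
    obtain ⟨z, hz⟩ := exists_ne (0 : M₁ ⧸ M₂.submoduleOf M₁)
    obtain ⟨y, rfl⟩ := X.symm_comp_cover_surjective e z
    rw [← hf, hf0] at hz
    exact hz (by simp)

end Basic

/-! ### Modules whose composition factors are bounded by a weight -/

section Factors

variable {A : Type u} [Ring A] {Λ : Type x} [PartialOrder Λ] {X : SimpleIndexing A Λ}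
variable {M : Type*} [AddCommGroup M] [Module A M] {N : Type*} [AddCommGroup N] [Module A N]

theorem FactorsLE.le {l m : Λ} (h : X.FactorsLE l M) {f : X.P m →ₗ[A] M} (hf : f ≠ 0) : m ≤ l :=
  X.factorsLE_iff.mp h m f hf

theorem FactorsLE.mono {l l' : Λ} (h : X.FactorsLE l M) (hl : l ≤ l') : X.FactorsLE l' M :=
  X.factorsLE_iff.mpr fun _ _ hf => (h.le hf).trans hl

theorem FactorsLE.of_injective {l : Λ} (h : X.FactorsLE l N) (i : M →ₗ[A] N)
    (hi : Function.Injective i) : X.FactorsLE l M :=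
  X.factorsLE_iff.mpr fun _ f hf => h.le (f := i ∘ₗ f) fun h0 => hf <| by
    ext y
    exact hi (by simpa using congrArg (fun q => q y) h0)

theorem FactorsLE.of_surjective {l : Λ} (h : X.FactorsLE l M) (p : M →ₗ[A] N)
    (hp : Function.Surjective p) : X.FactorsLE l N :=
  X.factorsLE_iff.mpr fun m f hf => by
    obtain ⟨g, rfl⟩ := Module.projective_lifting_property p f hp
    exact h.le (f := g) fun h0 => hf (by rw [h0, LinearMap.comp_zero])

theorem FactorsLE.range {l : Λ} (h : X.FactorsLE l M) (f : M →ₗ[A] N) :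
    X.FactorsLE l (LinearMap.range f) :=
  h.of_surjective f.rangeRestrict f.surjective_rangeRestrict

theorem FactorsLE.of_le {l : Λ} {N₁ N₂ : Submodule A M} (h : X.FactorsLE l N₂) (hle : N₁ ≤ N₂) :
    X.FactorsLE l N₁ :=
  h.of_injective _ (Submodule.inclusion_injective hle)

/-- Extensions: if the image and the kernel of a map have factors `≤ l`, so does the source. -/
theorem FactorsLE.of_ker {l : Λ} (p : M →ₗ[A] N) (hN : X.FactorsLE l (LinearMap.range p))
    (hk : X.FactorsLE l (LinearMap.ker p)) : X.FactorsLE l M :=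
  X.factorsLE_iff.mpr fun m f hf => by
    by_cases h0 : p ∘ₗ f = 0
    · refine hk.le (f := f.codRestrict _ fun y => LinearMap.congr_fun h0 y) fun h1 => hf ?_
      ext y
      exact congrArg (fun q => ((q y : LinearMap.ker p) : M)) h1
    · exact hN.le (f := p.rangeRestrict ∘ₗ f) fun h1 => h0 <| by
        ext y
        exact congrArg Subtype.val (LinearMap.congr_fun h1 y)

/-- A version of `FactorsLE.of_ker` for submodules. -/
theorem FactorsLE.of_range_mkQ {l : Λ} (h : M →ₗ[A] N) {N₁ : Submodule A N} (h₁ : X.FactorsLE l N₁)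
    (hq : X.FactorsLE l (LinearMap.range (N₁.mkQ ∘ₗ h))) : X.FactorsLE l (LinearMap.range h) := by
  refine FactorsLE.of_ker (N₁.mkQ ∘ₗ Submodule.subtype _) (hq.of_le ?_) (h₁.of_injective
    ((Submodule.subtype _ ∘ₗ Submodule.subtype _).codRestrict N₁ fun y => ?_) ?_)
  · rintro _ ⟨⟨_, y, rfl⟩, rfl⟩
    exact ⟨y, rfl⟩
  · exact (Submodule.Quotient.mk_eq_zero _).mp y.2
  · intro y z hyz
    have h1 : ((y : LinearMap.range h) : N) = (z : LinearMap.range h) := by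
      simpa using congrArg Subtype.val hyz
    exact Subtype.ext (Subtype.ext h1)

theorem FactorsLE.sup {l : Λ} {N₁ N₂ : Submodule A M} (h₁ : X.FactorsLE l N₁)
    (h₂ : X.FactorsLE l N₂) : X.FactorsLE l (N₁ ⊔ N₂ : Submodule A M) := by
  refine FactorsLE.of_ker (N₁.submoduleOf (N₁ ⊔ N₂)).mkQ ?_ ?_
  · rw [Submodule.range_mkQ]
    refine FactorsLE.of_injective ?_ (Submodule.subtype ⊤) (Submodule.subtype_injective _)
    refine h₂.of_surjective ((N₁.submoduleOf (N₁ ⊔ N₂)).mkQ ∘ₗ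
      Submodule.inclusion le_sup_right) ?_
    intro q
    obtain ⟨⟨q, hq⟩, rfl⟩ := Submodule.mkQ_surjective _ q
    obtain ⟨a, ha, b, hb, rfl⟩ := Submodule.mem_sup.mp hq
    refine ⟨⟨b, hb⟩, ?_⟩
    rw [LinearMap.comp_apply, ← sub_eq_zero, ← map_sub]
    refine (Submodule.Quotient.mk_eq_zero _).mpr ?_
    rw [Submodule.mem_submoduleOf_iff]
    simpa using ha
  · rw [Submodule.ker_mkQ]
    exact h₁.of_injective (Submodule.submoduleOfEquivOfLe le_sup_left).toLinearMap
      (LinearEquiv.injective _)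

variable (X) in
theorem factorsLE_bot (l : Λ) : X.FactorsLE l (⊥ : Submodule A M) :=
  X.factorsLE_iff.mpr fun _ _ hf => absurd (Subsingleton.elim _ _) hf

variable (X) in
/-- The sum of all submodules with composition factors `≤ l` has composition factors `≤ l`. -/
theorem factorsLE_sSup (l : Λ) : X.FactorsLE l
    (sSup {N : Submodule A M | X.FactorsLE l N} : Submodule A M) := by
  refine X.factorsLE_iff.mpr fun m f hf => ?_
  -- As `P m` is cyclic, its image lies in one member of the directed family as soon as the image of
  -- a generator does.
  obtain ⟨y, hy⟩ := X.exists_span_eq_top m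
  have hd : DirectedOn (· ≤ ·) {N : Submodule A M | X.FactorsLE l N} :=
    fun N₁ h₁ N₂ h₂ => ⟨N₁ ⊔ N₂, h₁.sup h₂, le_sup_left, le_sup_right⟩
  obtain ⟨N, hN, hyN⟩ := (Submodule.mem_sSup_of_directed ⟨⊥, X.factorsLE_bot l⟩ hd).mp (f y).2
  have hN' : X.FactorsLE l N := hN
  have hall : ∀ z, (f z : M) ∈ N := fun z => by
    obtain ⟨a, rfl⟩ := Submodule.mem_span_singleton.mp (hy ▸ trivial : z ∈ Submodule.span A {y})
    rw [map_smul]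
    exact N.smul_mem a hyN
  refine hN'.le (f := (Submodule.subtype _ ∘ₗ f).codRestrict N hall) fun h0 => hf ?_
  ext z
  exact congrArg (fun q => ((q z : N) : M)) h0

variable (X)

theorem factorsLE_costandard (l : Λ) : X.FactorsLE l (X.costandard l) := X.factorsLE_sSup l

theorem le_costandard {l : Λ} {N : Submodule A (X.I l)} (h : X.FactorsLE l N) :
    N ≤ X.costandard l := le_sSup h

/-- A non-zero test map lifts to `P l` and stays non-zero modulo one of the submodules whose
intersection is `standardKernel`; the bound on that quotient applies. -/
theorem factorsLE_standard (l : Λ) : X.FactorsLE l (X.Standard l) := by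
  refine X.factorsLE_iff.mpr fun m f hf => ?_
  obtain ⟨y, hy⟩ : ∃ y, f y ≠ 0 := by
    by_contra! h
    exact hf (LinearMap.ext h)
  obtain ⟨g, rfl⟩ := Module.projective_lifting_property (X.standardKernel l).mkQ f
    (Submodule.mkQ_surjective _)
  have hy' : g y ∉ X.standardKernel l := fun h => hy ((Submodule.Quotient.mk_eq_zero _).mpr h)
  simp only [standardKernel, Submodule.mem_sInf, not_forall] at hy'
  obtain ⟨N, hN, hyN⟩ := hy'
  have hN' : X.FactorsLE l (X.P l ⧸ N) := hN
  exact hN'.le (f := N.mkQ ∘ₗ g) fun h0 =>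
    hyN ((Submodule.Quotient.mk_eq_zero _).mp (congrArg (fun q => q y) h0))

/-- Together with `factorsLE_range_of_standardKernel_le`: a map out of `P l` factors through `Δ l`
exactly when its image has factors `≤ l`. -/
theorem standardKernel_le_ker {l : Λ} (f : X.P l →ₗ[A] M) (h : X.FactorsLE l (LinearMap.range f)) :
    X.standardKernel l ≤ LinearMap.ker f :=
  sInf_le (h.of_injective f.quotKerEquivRange.toLinearMap f.quotKerEquivRange.injective)

theorem factorsLE_L (l : Λ) : X.FactorsLE l (X.L l) :=
  X.factorsLE_iff.mpr fun _ f hf => (X.eq_of_hom_ne_zero (LinearEquiv.refl A _) f hf).le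

theorem standardKernel_le_ker_cover (l : Λ) : X.standardKernel l ≤ LinearMap.ker (X.cover l) :=
  X.standardKernel_le_ker _
    ((X.factorsLE_L l).of_injective (Submodule.subtype _) (Submodule.subtype_injective _))

theorem range_hull_le_costandard (l : Λ) : LinearMap.range (X.hull l) ≤ X.costandard l :=
  X.le_costandard ((X.factorsLE_L l).range _)

/-- A map killing `standardKernel` has image with factors `≤ l`. -/
theorem factorsLE_range_of_standardKernel_le {l : Λ} (f : X.P l →ₗ[A] M)
    (h : X.standardKernel l ≤ LinearMap.ker f) : X.FactorsLE l (LinearMap.range f) := by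
  refine (X.factorsLE_standard l).of_surjective
    (((X.standardKernel l).liftQ f h).codRestrict (LinearMap.range f) ?_) ?_
  · rintro ⟨y⟩
    exact ⟨y, rfl⟩
  · rintro ⟨_, y, rfl⟩
    exact ⟨Submodule.Quotient.mk y, rfl⟩

end Factors

end SimpleIndexing

/-! ### Gluing of linear maps and Fitting's lemma -/

section LinearAlgebra

variable {R : Type*} [Ring R] {M N P Q : Type*} [AddCommGroup M] [Module R M] [AddCommGroup N]
  [Module R N] [AddCommGroup P] [Module R P] [AddCommGroup Q] [Module R Q]

theorem LinearMap.exists_comp_eq_of_ker_le (s : M →ₗ[R] N) (hs : Function.Surjective s)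
    (f : M →ₗ[R] P) (h : LinearMap.ker s ≤ LinearMap.ker f) : ∃ g : N →ₗ[R] P, g ∘ₗ s = f := by
  refine ⟨(LinearMap.ker s).liftQ f h ∘ₗ (s.quotKerEquivOfSurjective hs).symm.toLinearMap, ?_⟩
  ext y
  have : (s.quotKerEquivOfSurjective hs).symm (s y) = Submodule.Quotient.mk y := by
    rw [LinearEquiv.symm_apply_eq]
    rfl
  simp [this]

/-- A map from a projective module into `N₁ + im p` lifts to the source of `p` modulo `N₁`. -/
theorem Module.Projective.exists_sub_mem [Module.Projective R Q] {N₁ : Submodule R M}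
    (p : P →ₗ[R] M) (t : Q →ₗ[R] M) (h : LinearMap.range t ≤ N₁ ⊔ LinearMap.range p) :
    ∃ r : Q →ₗ[R] P, ∀ y, t y - p (r y) ∈ N₁ := by
  have hm : ∀ y, (N₁.mkQ ∘ₗ t) y ∈ LinearMap.range (N₁.mkQ ∘ₗ p) := fun y => by
    obtain ⟨a, ha, _, ⟨b, rfl⟩, hab⟩ := Submodule.mem_sup.mp (h ⟨y, rfl⟩)
    refine ⟨b, ?_⟩
    rw [LinearMap.comp_apply, LinearMap.comp_apply, ← hab, map_add]
    simp [(Submodule.Quotient.mk_eq_zero N₁).mpr ha]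
  obtain ⟨r, hr⟩ := Module.projective_lifting_property (N₁.mkQ ∘ₗ p).rangeRestrict
    ((N₁.mkQ ∘ₗ t).codRestrict _ hm) (N₁.mkQ ∘ₗ p).surjective_rangeRestrict
  refine ⟨r, fun y => ?_⟩
  have h1 : N₁.mkQ (p (r y)) = N₁.mkQ (t y) :=
    congrArg Subtype.val (LinearMap.congr_fun hr y)
  rw [← Submodule.ker_mkQ N₁, LinearMap.mem_ker, map_sub, h1, sub_self]

/-- Extension of a map from `N₁` to `N₁ + im p`. -/
theorem Submodule.exists_extend_of_eq_sup {N₁ N₂ : Submodule R M} (p : P →ₗ[R] M)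
    (hN : N₂ = N₁ ⊔ LinearMap.range p) (φ : N₁ →ₗ[R] N) (q : P →ₗ[R] N)
    (hq : ∀ y (hy : p y ∈ N₁), φ ⟨p y, hy⟩ = q y) :
    ∃ ψ : N₂ →ₗ[R] N, (∀ z (hz : z ∈ N₁) (hz' : z ∈ N₂), ψ ⟨z, hz'⟩ = φ ⟨z, hz⟩) ∧
      (∀ y (hy : p y ∈ N₂), ψ ⟨p y, hy⟩ = q y) ∧
      LinearMap.range ψ ≤ LinearMap.range φ ⊔ LinearMap.range q := by
  have hm : ∀ a, N₁.subtype.coprod p a ∈ N₂ := fun a => by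
    rw [hN]
    exact Submodule.add_mem_sup a.1.2 ⟨a.2, rfl⟩
  let s : (N₁ × P) →ₗ[R] N₂ := (N₁.subtype.coprod p).codRestrict N₂ hm
  have hs : Function.Surjective s := by
    rintro ⟨z, hz⟩
    rw [hN] at hz
    obtain ⟨a, ha, _, ⟨b, rfl⟩, rfl⟩ := Submodule.mem_sup.mp hz
    exact ⟨(⟨a, ha⟩, b), rfl⟩
  obtain ⟨ψ, hψ⟩ := LinearMap.exists_comp_eq_of_ker_le s hs (φ.coprod q) (by
    rintro ⟨⟨a, ha⟩, b⟩ hab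
    have hab' : a + p b = 0 := congrArg Subtype.val hab
    have hpb : p b = -a := by rw [eq_neg_iff_add_eq_zero, add_comm, hab']
    have hb : p b ∈ N₁ := hpb ▸ N₁.neg_mem ha
    have h1 := hq b hb
    rw [LinearMap.mem_ker, LinearMap.coprod_apply, ← h1, ← map_add]
    convert φ.map_zero using 2
    exact Subtype.ext hab')
  refine ⟨ψ, fun z hz hz' => ?_, fun y hy => ?_, ?_⟩
  · have := LinearMap.congr_fun hψ (⟨z, hz⟩, 0)
    simp only [LinearMap.comp_apply, LinearMap.coprod_apply, map_zero, add_zero] at this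
    rw [← this]
    exact congrArg ψ (Subtype.ext (by simp [s]))
  · have := LinearMap.congr_fun hψ (0, y)
    simp only [LinearMap.comp_apply, LinearMap.coprod_apply, map_zero, zero_add] at this
    rw [← this]
    exact congrArg ψ (Subtype.ext (by simp [s]))
  · rintro _ ⟨z, rfl⟩
    obtain ⟨a, rfl⟩ := hs z
    have := LinearMap.congr_fun hψ a
    rw [LinearMap.comp_apply] at this
    rw [this, LinearMap.coprod_apply]
    exact Submodule.add_mem_sup ⟨_, rfl⟩ ⟨_, rfl⟩

/-- Fitting: an injective-or-nilpotent alternative for endomorphisms of indecomposables. -/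
theorem IsIndecomposableModule.injective_or_pow_eq_zero {A : Type*} [Ring A] {M : Type*}
    [AddCommGroup M] [Module A M] [IsNoetherian A M] [IsArtinian A M]
    (h : IsIndecomposableModule A M) (φ : Module.End A M) :
    Function.Injective φ ∨ ∃ n, φ ^ n = 0 := by
  obtain ⟨n, hn⟩ := Filter.eventually_atTop.mp (LinearMap.eventually_isCompl_ker_pow_range_pow φ)
  rcases h.2 _ _ (hn (n + 1) (Nat.le_succ n)) with h0 | h0
  · left
    have h1 := LinearMap.ker_eq_bot.mp h0
    rw [pow_succ] at h1
    exact Function.Injective.of_comp h1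
  · exact Or.inr ⟨n + 1, LinearMap.range_eq_bot.mp h0⟩

end LinearAlgebra

namespace SimpleIndexing

variable {A : Type u} [Ring A] {Λ : Type x} [PartialOrder Λ] (X : SimpleIndexing A Λ)

/-! ### Modules with a standard filtration -/

section Filtrations

variable {M : Type*} [AddCommGroup M] [Module A M] {N : Type*} [AddCommGroup N] [Module A N]

/-- A subquotient `N₂ / N₁ ≅ Δ m` is covered by a map from `P m`. -/
theorem exists_hom_of_linearEquiv_standard {m : Λ} {N₁ N₂ : Submodule A M} (hle : N₁ ≤ N₂)
    (e : (N₂ ⧸ N₁.submoduleOf N₂) ≃ₗ[A] X.Standard m) :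
    ∃ p : X.P m →ₗ[A] M, N₂ = N₁ ⊔ LinearMap.range p ∧ ∀ y, p y ∈ N₁ ↔ y ∈ X.standardKernel m := by
  obtain ⟨p, hp⟩ := Module.projective_lifting_property (N₁.submoduleOf N₂).mkQ
    (e.symm.toLinearMap ∘ₗ (X.standardKernel m).mkQ) (Submodule.mkQ_surjective _)
  have hp' : ∀ y, (N₁.submoduleOf N₂).mkQ (p y) = e.symm ((X.standardKernel m).mkQ y) :=
    fun y => LinearMap.congr_fun hp y
  refine ⟨N₂.subtype ∘ₗ p, le_antisymm (fun z hz => ?_) (sup_le hle ?_), fun y => ?_⟩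
  · obtain ⟨y, hy⟩ := (X.standardKernel m).mkQ_surjective (e ((N₁.submoduleOf N₂).mkQ ⟨z, hz⟩))
    have h1 := hp' y
    rw [hy, e.symm_apply_apply, eq_comm, ← sub_eq_zero, ← map_sub] at h1
    have h2 : z - (p y : M) ∈ N₁ :=
      (Submodule.Quotient.mk_eq_zero (N₁.submoduleOf N₂)).mp h1
    rw [← sub_add_cancel z (p y : M)]
    exact Submodule.add_mem_sup h2 ⟨y, rfl⟩
  · rintro _ ⟨y, rfl⟩
    exact (p y).2
  · rw [← Submodule.Quotient.mk_eq_zero (X.standardKernel m), ← Submodule.mkQ_apply,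
      ← e.symm.map_eq_zero_iff, ← hp', Submodule.mkQ_apply, Submodule.Quotient.mk_eq_zero]
    rfl

variable {X}

/-- Each step of the filtration is the previous one plus the image of some `P m`, so a map killing
all such images vanishes. For the kernel of `P l → Δ l` this is what makes weights strictly
increase. -/
theorem exists_hom_comp_ne_zero_of_standardFiltration {s : Set Λ}
    (h : HasModuleFiltration A (fun m => X.Standard m) s M) {g : M →ₗ[A] N} (hg : g ≠ 0) :
    ∃ m ∈ s, ∃ f : X.P m →ₗ[A] M, g ∘ₗ f ≠ 0 := by
  obtain ⟨n, C, hC, h0, hn, hs⟩ := h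
  by_contra! hcon
  have key : ∀ k ≤ n, C k ≤ LinearMap.ker g := by
    intro k
    induction k with
    | zero => exact fun _ => h0 ▸ bot_le
    | succ k ih =>
      intro hk
      obtain ⟨m, hm, ⟨e⟩⟩ := hs k hk
      obtain ⟨p, hp, -⟩ := X.exists_hom_of_linearEquiv_standard (hC (Nat.le_succ k)) e
      rw [hp]
      refine sup_le (ih (by omega)) ?_
      rintro _ ⟨y, rfl⟩
      exact LinearMap.congr_fun (hcon m hm p) y
  exact hg (LinearMap.ker_eq_top.mp (top_le_iff.mp (hn ▸ key n le_rfl)))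

theorem finite_of_standardFiltration {s : Set Λ}
    (h : HasModuleFiltration A (fun m => X.Standard m) s M) : Module.Finite A M := by
  obtain ⟨n, C, hC, h0, hn, hs⟩ := h
  have key : ∀ k ≤ n, (C k).FG := by
    intro k
    induction k with
    | zero => exact fun _ => h0 ▸ Submodule.fg_bot
    | succ k ih =>
      intro hk
      obtain ⟨m, hm, ⟨e⟩⟩ := hs k hk
      obtain ⟨p, hp, -⟩ := X.exists_hom_of_linearEquiv_standard (hC (Nat.le_succ k)) e
      rw [hp]
      exact (ih (by omega)).sup (LinearMap.range_eq_map p ▸ (Module.Finite.fg_top).map p)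
  exact ⟨hn ▸ key n le_rfl⟩

end Filtrations

/-! ### Vanishing of extensions of standard modules -/

section Ext

variable (M : Type*) [AddCommGroup M] [Module A M]

/-- `Ext¹(Δ m, M) = 0` for all `m`: all maps to `M` extend from the kernel of `P m → Δ m`. -/
def StandardAcyclic : Prop :=
  ∀ (m : Λ) (g : X.standardKernel m →ₗ[A] M), ∃ h : X.P m →ₗ[A] M, ∀ y : X.standardKernel m, h y = g y

variable {X M}
variable (hK : ∀ l, HasModuleFiltration A (fun m => X.Standard m) {m | l < m} (X.standardKernel l))

-- A non-zero map would be seen by some `P k` with `m < k`, and the bound on `M` gives `k ≤ l`.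
include hK in
theorem eq_zero_of_factorsLE {l m : Λ} (h : X.FactorsLE l M) (hm : ¬ m < l)
    (g : X.standardKernel m →ₗ[A] M) : g = 0 := by
  by_contra hg
  obtain ⟨k, hk, f, hf⟩ := exists_hom_comp_ne_zero_of_standardFiltration (hK m) hg
  exact hm (lt_of_lt_of_le hk (h.le hf))

-- For `m < l`, extend into the injective `I l`. Modulo `∇ l` the image is a quotient of `Δ m`, so
-- all its factors are `≤ l` and it lies in `∇ l` by maximality. In the other cases there is no
-- non-zero map to extend.
include hK in
theorem standardAcyclic_costandard (l : Λ) : X.StandardAcyclic (X.costandard l) := by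
  intro m g
  by_cases hm : m < l
  · have := (X.isInjectiveHull l).1
    obtain ⟨h, hh⟩ := Module.Injective.extension_property A _ _ (M := X.I l)
      (X.standardKernel m).subtype (Submodule.subtype_injective _) (Submodule.subtype _ ∘ₗ g)
    have hh' : ∀ y : X.standardKernel m, h y = g y := fun y => LinearMap.congr_fun hh y
    have hr : LinearMap.range h ≤ X.costandard l := by
      refine X.le_costandard (FactorsLE.of_range_mkQ h (X.factorsLE_costandard l)
        ((X.factorsLE_range_of_standardKernel_le _ fun y hy => ?_).mono hm.le))
      refine (Submodule.Quotient.mk_eq_zero _).mpr ?_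
      rw [hh' ⟨y, hy⟩]
      exact (g ⟨y, hy⟩).2
    exact ⟨h.codRestrict _ fun y => hr ⟨y, rfl⟩, fun y => Subtype.ext (hh' y)⟩
  · refine ⟨0, fun y => ?_⟩
    rw [eq_zero_of_factorsLE hK (X.factorsLE_costandard l) hm g]
    rfl

-- Induction on the step containing the image of `g`: extend modulo `C k` by the costandard case,
-- lift to `C (k + 1)` by projectivity of `P m`, and extend the difference, whose image lies in `C
-- k`.
include hK in
theorem standardAcyclic_of_costandardFiltration {s : Set Λ}
    (h : HasModuleFiltration A (fun m => X.costandard m) s M) : X.StandardAcyclic M := by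
  obtain ⟨n, C, hC, h0, hn, hs⟩ := h
  have key : ∀ k ≤ n, ∀ (m : Λ) (g : X.standardKernel m →ₗ[A] M), LinearMap.range g ≤ C k →
      ∃ h : X.P m →ₗ[A] M, ∀ y : X.standardKernel m, h y = g y := by
    intro k
    induction k with
    | zero =>
      intro _ m g hg
      refine ⟨0, fun y => ?_⟩
      rw [h0] at hg
      exact (hg ⟨y, rfl⟩ : g y = 0).symm
    | succ k ih =>
      intro hk m g hg
      obtain ⟨l, hl, ⟨e⟩⟩ := hs k hk
      let g' : X.standardKernel m →ₗ[A] C (k + 1) := g.codRestrict _ fun y => hg ⟨y, rfl⟩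
      obtain ⟨h, hh⟩ := standardAcyclic_costandard hK l m
        (e.toLinearMap ∘ₗ Submodule.mkQ _ ∘ₗ g')
      obtain ⟨h', hh'⟩ := Module.projective_lifting_property
        ((C k).submoduleOf (C (k + 1))).mkQ (e.symm.toLinearMap ∘ₗ h) (Submodule.mkQ_surjective _)
      have hd : ∀ y : X.standardKernel m, g y - (h' y : M) ∈ C k := fun y => by
        have h1 : ((C k).submoduleOf (C (k + 1))).mkQ (h' y) =
            ((C k).submoduleOf (C (k + 1))).mkQ (g' y) := by
          refine (LinearMap.congr_fun hh' y).trans ?_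
          simp [hh]
        rw [eq_comm, ← sub_eq_zero, ← map_sub] at h1
        exact (Submodule.Quotient.mk_eq_zero ((C k).submoduleOf (C (k + 1)))).mp h1
      obtain ⟨h'', hh''⟩ := ih (by omega) m (g - (C (k + 1)).subtype ∘ₗ h' ∘ₗ Submodule.subtype _)
        (by
          rintro _ ⟨y, rfl⟩
          exact hd y)
      refine ⟨h'' + (C (k + 1)).subtype ∘ₗ h', fun y => ?_⟩
      rw [LinearMap.add_apply, hh'']
      simp
  exact fun m g => key n le_rfl m g (hn ▸ le_top)

include hK in
/-- Maps from `P m` to `I l` whose image is not in `∇ l` but whose restriction to the kernel of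
`P m → Δ m` is exist only for `l < m`. -/
theorem lt_of_not_range_le_costandard {l m : Λ} (g : X.P m →ₗ[A] X.I l)
    (hg : ¬ LinearMap.range g ≤ X.costandard l)
    (hgK : ∀ y ∈ X.standardKernel m, g y ∈ X.costandard l) : l < m := by
  -- Subtracting a map into `∇ l` makes `g` factor through `Δ m` without moving it into `∇ l`. The
  -- difference is non-zero, so it contains the socle `L l` of `I l`, whence `l ≤ m`.
  obtain ⟨g₀, hg₀⟩ := standardAcyclic_costandard hK l m
    ((g ∘ₗ Submodule.subtype _).codRestrict (X.costandard l) fun y => hgK y y.2)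
  let d := g - (X.costandard l).subtype ∘ₗ g₀
  have hdK : X.standardKernel m ≤ LinearMap.ker d := fun y hy => by
    have : (g₀ y : X.I l) = g y := congrArg Subtype.val (hg₀ ⟨y, hy⟩)
    simpa [d, sub_eq_zero] using this.symm
  have hd := X.factorsLE_range_of_standardKernel_le d hdK
  have hnd : ¬ LinearMap.range d ≤ X.costandard l := fun hle => hg <| by
    rintro _ ⟨y, rfl⟩
    have h1 : g y = d y + g₀ y := by simp [d]
    rw [h1]
    exact Submodule.add_mem _ (hle ⟨y, rfl⟩) (g₀ y).2
  have hbot : LinearMap.range d ⊓ LinearMap.range (X.hull l) ≠ ⊥ := fun h =>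
    hnd (((X.isInjectiveHull l).2.2 _ h).le.trans bot_le)
  have hat : IsAtom (LinearMap.range (X.hull l)) := isSimpleModule_iff_isAtom.mp
    (IsSimpleModule.congr (LinearEquiv.ofInjective _ (X.isInjectiveHull l).2.1).symm)
  have hle : LinearMap.range (X.hull l) ≤ LinearMap.range d :=
    inf_eq_right.mp ((hat.le_iff.mp inf_le_right).resolve_left hbot)
  have hlm : l ≤ m := hd.le (f := (X.hull l ∘ₗ X.cover l).codRestrict _ fun y => hle ⟨_, rfl⟩) <| by
    intro h0
    refine (X.isCoatom_ker_cover l).1 (eq_top_iff.mpr fun y _ => ?_)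
    refine (X.isInjectiveHull l).2.1 ?_
    rw [map_zero]
    exact congrArg Subtype.val (LinearMap.congr_fun h0 y)
  refine lt_of_le_of_ne hlm fun h => hnd ?_
  subst h
  exact X.le_costandard hd

end Ext

end SimpleIndexing

/-- Multiplication by a scalar, as an `A`-linear map. -/
def algebraMapSMul {K : Type*} {A : Type*} [Field K] [Ring A] [Algebra K A] (c : K)
    (M : Type*) [AddCommGroup M] [Module A M] : M →ₗ[A] M where
  toFun y := algebraMap K A c • y
  map_add' := smul_add _
  map_smul' a y := by simp only [smul_smul, Algebra.commutes, RingHom.id_apply]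

namespace SimpleIndexing

variable {K : Type v} {A : Type u} [Field K] [Ring A] [Algebra K A]
variable {Λ : Type x} {X : SimpleIndexing A Λ}

variable (X) in
theorem hull_comp_cover_ne_zero (l : Λ) : X.hull l ∘ₗ X.cover l ≠ 0 := fun h0 =>
  (X.isCoatom_ker_cover l).1 (eq_top_iff.mpr fun y _ => (X.isInjectiveHull l).2.1 (by
    rw [map_zero]
    exact LinearMap.congr_fun h0 y))

variable (X) in
theorem isAtom_range_hull (l : Λ) : IsAtom (LinearMap.range (X.hull l)) :=
  isSimpleModule_iff_isAtom.mp
    (IsSimpleModule.congr (LinearEquiv.ofInjective _ (X.isInjectiveHull l).2.1).symm)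

variable (X) in
theorem range_hull_le {l : Λ} {N : Submodule A (X.I l)} (hN : N ≠ ⊥) :
    LinearMap.range (X.hull l) ≤ N :=
  inf_eq_right.mp (((X.isAtom_range_hull l).le_iff.mp inf_le_right).resolve_left fun h =>
    hN ((X.isInjectiveHull l).2.2 _ h))

variable [PartialOrder Λ]

theorem IsQuasiHereditary.filtration (hA : X.IsQuasiHereditary K) (l : Λ) :
    HasModuleFiltration A (fun m => X.Standard m) {m | l < m} (X.standardKernel l) := (hA l).2

/-- Endomorphisms of `P l` are scalars modulo the kernel of `P l → Δ l`. -/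
theorem IsQuasiHereditary.exists_sub_mem (hA : X.IsQuasiHereditary K) {l : Λ}
    (r : X.P l →ₗ[A] X.P l) :
    ∃ c : K, ∀ y, r y - algebraMap K A c • y ∈ X.standardKernel l := by
  have h : X.standardKernel l ≤ (X.standardKernel l).comap r := by
    have := X.standardKernel_le_ker ((X.standardKernel l).mkQ ∘ₗ r)
      ((X.factorsLE_standard l).of_injective _ (Submodule.subtype_injective _))
    rwa [LinearMap.ker_comp, Submodule.ker_mkQ] at this
  obtain ⟨c, hc⟩ := (hA l).1 ((X.standardKernel l).mapQ _ r h)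
  refine ⟨c, fun y => (Submodule.Quotient.mk_eq_zero _).mp ?_⟩
  rw [Submodule.Quotient.mk_sub, sub_eq_zero, Submodule.Quotient.mk_smul]
  exact hc (Submodule.Quotient.mk y)

/-- All maps `P l → ∇ l` are multiples of the map with image the socle. -/
theorem IsQuasiHereditary.eq_smul_of_range_le_costandard (hA : X.IsQuasiHereditary K) {l : Λ}
    (g : X.P l →ₗ[A] X.I l) (hg : LinearMap.range g ≤ X.costandard l) :
    ∃ c : K, ∀ y, g y = algebraMap K A c • X.hull l (X.cover l y) := by
  by_cases h0 : g = 0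
  · exact ⟨0, by simp [h0]⟩
  have hle := X.range_hull_le (N := LinearMap.range g) fun h => h0 (LinearMap.range_eq_bot.mp h)
  -- The socle map lifts through `g` to an endomorphism `r` of `P l`, a scalar `c` modulo a
  -- submodule that `g` kills; so `c` times `g` is the socle map, and `c ≠ 0`.
  obtain ⟨r, hr⟩ := Module.projective_lifting_property g.rangeRestrict
    ((X.hull l ∘ₗ X.cover l).codRestrict _ fun y => hle ⟨_, rfl⟩) g.surjective_rangeRestrict
  have hr' : ∀ y, g (r y) = X.hull l (X.cover l y) := fun y =>
    congrArg Subtype.val (LinearMap.congr_fun hr y)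
  obtain ⟨c, hc⟩ := hA.exists_sub_mem r
  have hk := X.standardKernel_le_ker g ((X.factorsLE_costandard l).of_le hg)
  have hc' : ∀ y, algebraMap K A c • g y = X.hull l (X.cover l y) := fun y => by
    have := hk (hc y)
    rw [LinearMap.mem_ker, map_sub, map_smul, sub_eq_zero, hr'] at this
    exact this.symm
  have hc0 : c ≠ 0 := fun h => X.hull_comp_cover_ne_zero l <| by
    ext y
    rw [LinearMap.comp_apply, ← hc', h]
    simp
  refine ⟨c⁻¹, fun y => ?_⟩
  rw [← hc', smul_smul, ← map_mul, inv_mul_cancel₀ hc0, map_one, one_smul]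

/-! ### Maps between projectives and the indecomposable tilting module -/

section Tilting

variable {T : Type w} [AddCommGroup T] [Module A T]

/-- If `Δ m → T → ∇ m` is non-zero, some endomorphism of `T` with image in factors `≤ m` does not
change the composites `P m → T → ∇ m`. -/
theorem exists_end_of_comp_ne_zero (hA : X.IsQuasiHereditary K) {s : Set Λ}
    (hT : HasModuleFiltration A (fun m => X.Standard m) s T) (hac : X.StandardAcyclic T)
    {m : Λ} (f : X.P m →ₗ[A] T) (h : T →ₗ[A] X.I m)
    (hf : X.standardKernel m ≤ LinearMap.ker f) (hh : LinearMap.range h ≤ X.costandard m)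
    (hhf : h ∘ₗ f = X.hull m ∘ₗ X.cover m) :
    ∃ φ : T →ₗ[A] T, X.FactorsLE m (LinearMap.range φ) ∧
      ∀ t : X.P m →ₗ[A] T, h ∘ₗ φ ∘ₗ t = h ∘ₗ t := by
  obtain ⟨n, C, hC, h0, hn, hs⟩ := hT
  -- The endomorphism is built along the standard filtration, keeping its effect after `h` equal to
  -- that of the inclusion on everything hit by `P m`.
  have key : ∀ k ≤ n, ∃ φ : C k →ₗ[A] T, X.FactorsLE m (LinearMap.range φ) ∧
      ∀ (t : X.P m →ₗ[A] C k) y, h (φ (t y)) = h (t y) := by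
    intro k
    induction k with
    | zero =>
      refine fun _ => ⟨0, ?_, fun t y => ?_⟩
      · rw [LinearMap.range_zero]
        exact X.factorsLE_bot m
      · have : (t y : T) = 0 := by
          rw [← Submodule.mem_bot A, ← h0]
          exact (t y).2
        simp [this]
    | succ k ih =>
      intro hk
      obtain ⟨φ, hφ, hφh⟩ := ih (by omega)
      obtain ⟨l, -, ⟨e⟩⟩ := hs k hk
      obtain ⟨p, hp, hpK⟩ := X.exists_hom_of_linearEquiv_standard (hC (Nat.le_succ k)) e
      let g : X.standardKernel l →ₗ[A] T :=
        φ ∘ₗ (p ∘ₗ Submodule.subtype _).codRestrict (C k) fun y => (hpK y).mpr y.2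
      have hgr : LinearMap.range g ≤ LinearMap.range φ := LinearMap.range_comp_le_range _ _
      have hg0 : ¬ l < m → g = 0 := fun hl => by
        have := eq_zero_of_factorsLE hA.filtration hφ hl
          (g.codRestrict (LinearMap.range φ) fun y => hgr ⟨y, rfl⟩)
        ext y
        exact congrArg Subtype.val (LinearMap.congr_fun this y)
      -- The new generator must be sent compatibly with `g`. If `l < m`, Ext-vanishing supplies `q`,
      -- and maps `P m → P l` land in `standardKernel l`, where the identity is already known. If `l
      -- = m`, then `h ∘ p` is a multiple of `h ∘ f`, so the same multiple of `f` works. Otherwise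
      -- `h ∘ p = 0`, and zero works.
      have hq : ∃ q : X.P l →ₗ[A] T, X.FactorsLE m (LinearMap.range q) ∧
          (∀ y : X.standardKernel l, q y = g y) ∧
          ∀ (r : X.P m →ₗ[A] X.P l) y, h (q (r y)) = h (p (r y)) := by
        by_cases hlm : l < m
        · obtain ⟨q, hq⟩ := hac l g
          refine ⟨q, ?_, hq, fun r y => ?_⟩
          · refine FactorsLE.of_range_mkQ q hφ
              ((X.factorsLE_range_of_standardKernel_le _ fun y hy => ?_).mono hlm.le)
            refine (Submodule.Quotient.mk_eq_zero _).mpr ?_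
            rw [hq ⟨y, hy⟩]
            exact hgr ⟨_, rfl⟩
          · have hr : ∀ y, r y ∈ X.standardKernel l := fun y => by
              by_contra hy
              refine not_le_of_gt hlm ((X.factorsLE_standard l).le
                (f := (X.standardKernel l).mkQ ∘ₗ r) fun h0 => hy ?_)
              exact (Submodule.Quotient.mk_eq_zero _).mp (LinearMap.congr_fun h0 y)
            have h1 := hφh ((p ∘ₗ r).codRestrict (C k) fun y => (hpK _).mpr (hr y)) y
            rw [hq ⟨r y, hr y⟩]
            exact h1
        · by_cases hlm' : l = m
          · subst hlm'
            obtain ⟨c, hc⟩ := hA.eq_smul_of_range_le_costandard (h ∘ₗ p)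
              ((LinearMap.range_comp_le_range _ _).trans hh)
            refine ⟨f ∘ₗ algebraMapSMul c _, (X.factorsLE_range_of_standardKernel_le f hf).of_le
              (LinearMap.range_comp_le_range _ _), fun y => ?_, fun r y => ?_⟩
            · rw [hg0 hlm]
              exact hf (Submodule.smul_mem _ _ y.2)
            · have h1 : h (p (r y)) = _ := hc (r y)
              rw [h1, ← LinearMap.comp_apply (X.hull l), ← hhf]
              simp [algebraMapSMul]
          · refine ⟨0, ?_, fun y => by rw [hg0 hlm]; rfl, fun r y => ?_⟩
            · rw [LinearMap.range_zero]
              exact X.factorsLE_bot m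
            · have h1 : h ∘ₗ p = 0 := by
                by_contra hne
                refine hlm (lt_of_le_of_ne ((X.factorsLE_costandard m).le
                  (f := (h ∘ₗ p).codRestrict _ fun y => hh ⟨_, rfl⟩) fun h2 => hne ?_) hlm')
                ext y
                exact congrArg Subtype.val (LinearMap.congr_fun h2 y)
              rw [LinearMap.zero_apply, map_zero]
              exact (LinearMap.congr_fun h1 (r y)).symm
      obtain ⟨q, hqr, hqg, hqh⟩ := hq
      obtain ⟨ψ, hψφ, hψq, hψr⟩ := Submodule.exists_extend_of_eq_sup p hp φ q
        fun y hy => (hqg ⟨y, (hpK y).mp hy⟩).symm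
      refine ⟨ψ, (hφ.sup hqr).of_le hψr, fun t y => ?_⟩
      obtain ⟨r, hr⟩ : ∃ r : X.P m →ₗ[A] X.P l, ∀ y, (t y : T) - p (r y) ∈ C k :=
        Module.Projective.exists_sub_mem p (Submodule.subtype _ ∘ₗ t) (by
          rw [← hp]
          rintro _ ⟨y, rfl⟩
          exact (t y).2)
      have hpm : ∀ y, p y ∈ C (k + 1) := fun y => by
        rw [hp]
        exact Submodule.mem_sup_right ⟨y, rfl⟩
      have hle : C k ≤ C (k + 1) := hC (Nat.le_succ k)
      have h1 : t y = (⟨(t y : T) - p (r y), hle (hr y)⟩ : C (k + 1)) +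
          ⟨p (r y), hpm _⟩ := Subtype.ext (by simp)
      have h2 := hφh ((Submodule.subtype _ ∘ₗ t - p ∘ₗ r).codRestrict (C k) hr) y
      have h3 : h (φ ⟨(t y : T) - p (r y), hr y⟩) = h ((t y : T) - p (r y)) := h2
      have h4 : ψ (t y) = φ ⟨(t y : T) - p (r y), hr y⟩ + q (r y) := by
        rw [← hψφ _ (hr y) (hle (hr y)), ← hψq _ (hpm _), ← map_add, ← h1]
      rw [h4, map_add, h3, hqh, ← map_add, sub_add_cancel]
  obtain ⟨φ, hφ, hφh⟩ := key n le_rfl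
  have hmem : ∀ z, z ∈ C n := fun z => hn ▸ trivial
  refine ⟨φ ∘ₗ LinearMap.id.codRestrict (C n) hmem,
    hφ.of_le (LinearMap.range_comp_le_range _ _), fun t => ?_⟩
  ext y
  exact hφh (t.codRestrict (C n) fun y => hmem _) y

/-- The endomorphism from `exists_end_of_comp_ne_zero` preserves a non-zero composite `P m → T → ∇
m`, so it is not nilpotent; by Fitting it is injective. Then the copy of `Δ l` in `T` embeds in a
module with factors `≤ m`, giving `l ≤ m`. -/
theorem IsIndecomposableTilting.eq_of_comp_ne_zero [IsNoetherian A T] [IsArtinian A T]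
    (hA : X.IsQuasiHereditary K)
    {l : Λ} (hT : X.IsIndecomposableTilting l T)
    {m : Λ} (f : X.P m →ₗ[A] T) (h : T →ₗ[A] X.I m)
    (hf : X.standardKernel m ≤ LinearMap.ker f) (hh : LinearMap.range h ≤ X.costandard m)
    (hhf : h ∘ₗ f = X.hull m ∘ₗ X.cover m) : m = l := by
  have hne := X.hull_comp_cover_ne_zero m
  obtain ⟨φ, hφ, hφh⟩ := exists_end_of_comp_ne_zero hA hT.standard_filtration
    (standardAcyclic_of_costandardFiltration hA.filtration hT.costandard_filtration) f h hf hh hhf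
  rcases hT.indecomposable.injective_or_pow_eq_zero φ with hi | ⟨n, hn⟩
  · refine le_antisymm (hT.factors_le.le (f := f) fun h0 => hne ?_) ?_
    · rw [← hhf, h0, LinearMap.comp_zero]
    · obtain ⟨N, ⟨e⟩, -⟩ := hT.unique_standard_sub
      refine (hφ.of_injective (φ.rangeRestrict ∘ₗ N.subtype ∘ₗ e.symm.toLinearMap) ?_).le
        (f := (X.standardKernel l).mkQ) fun h0 => ?_
      · intro y z hyz
        exact e.symm.injective (Subtype.ext (hi (congrArg Subtype.val hyz)))
      · have h1 := X.standardKernel_le_ker_cover l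
        rw [← Submodule.ker_mkQ (X.standardKernel l), h0, LinearMap.ker_zero] at h1
        exact (X.isCoatom_ker_cover l).1 (top_le_iff.mp h1)
  · exfalso
    have key : ∀ n, h ∘ₗ (φ ^ n : Module.End A T) ∘ₗ f = h ∘ₗ f := by
      intro n
      induction n with
      | zero => rfl
      | succ n ih =>
        rw [pow_succ']
        exact (hφh ((φ ^ n : Module.End A T) ∘ₗ f)).trans ih
    apply hne
    rw [← hhf, ← key n, hn]
    simp

variable (X) in
theorem exists_linearEquiv_of_ker_eq {l : Λ} (p : X.P l →ₗ[A] T)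
    (hp : LinearMap.ker p = X.standardKernel l) :
    Nonempty (LinearMap.range p ≃ₗ[A] X.Standard l) :=
  ⟨p.quotKerEquivRange.symm.trans (Submodule.quotEquivOfEq _ _ hp)⟩

/-- `Hom(P l, T(l))` is one-dimensional. -/
theorem IsIndecomposableTilting.exists_forall_eq_smul (hA : X.IsQuasiHereditary K)
    {l : Λ} (hT : X.IsIndecomposableTilting l T) :
    ∃ p : X.P l →ₗ[A] T, p ≠ 0 ∧
      ∀ f : X.P l →ₗ[A] T, ∃ c : K, ∀ y, f y = algebraMap K A c • p y := by
  have hKtop : X.standardKernel l ≠ ⊤ := fun h => (X.isCoatom_ker_cover l).1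
    (top_le_iff.mp (h ▸ X.standardKernel_le_ker_cover l))
  have hTK : ∀ f : X.P l →ₗ[A] T, X.standardKernel l ≤ LinearMap.ker f := fun f =>
    X.standardKernel_le_ker f (hT.factors_le.of_injective _ (Submodule.subtype_injective _))
  obtain ⟨n, C, hC, h0, hn, hs⟩ := hT.standard_filtration
  -- `D k` records that the `k`-th subquotient is `Δ l`. Exactly one such step exists, and it
  -- carries all maps from `P l`.
  let D : ℕ → Prop := fun k => ∃ p : X.P l →ₗ[A] T, C (k + 1) = C k ⊔ LinearMap.range p ∧
    ∀ y, p y ∈ C k ↔ y ∈ X.standardKernel l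
  -- A step `Δ m` has `m ≤ l`; a map from `P l` non-zero in it would also give `l ≤ m`.
  have drop : ∀ k < n, ¬ D k → ∀ f : X.P l →ₗ[A] T, LinearMap.range f ≤ C (k + 1) →
      LinearMap.range f ≤ C k := by
    intro k hk hD f hf
    obtain ⟨m, -, ⟨e⟩⟩ := hs k hk
    obtain ⟨p, hp, hpK⟩ := X.exists_hom_of_linearEquiv_standard (hC (Nat.le_succ k)) e
    have hml : m ≤ l := hT.factors_le.le (f := p) fun hp0 => by
      refine (X.isCoatom_ker_cover m).1 (top_le_iff.mp (le_trans (fun y _ => ?_)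
        (X.standardKernel_le_ker_cover m)))
      rw [← hpK, hp0]
      exact (C k).zero_mem
    obtain ⟨r, hr⟩ := Module.Projective.exists_sub_mem p f (hf.trans hp.le)
    have hr' : ∀ y, r y ∈ X.standardKernel m := fun y => by
      by_contra hy
      have hlm : l ≤ m := (X.factorsLE_standard m).le (f := (X.standardKernel m).mkQ ∘ₗ r)
        fun h0 => hy ((Submodule.Quotient.mk_eq_zero _).mp (LinearMap.congr_fun h0 y))
      obtain rfl := le_antisymm hlm hml
      exact hD ⟨p, hp, hpK⟩
    rintro _ ⟨y, rfl⟩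
    rw [← sub_add_cancel (f y) (p (r y))]
    exact Submodule.add_mem _ (hr y) ((hpK _).mpr (hr' y))
  have desc : ∀ a b, a ≤ b → b ≤ n → (∀ j, a ≤ j → j < b → ¬ D j) → ∀ f : X.P l →ₗ[A] T,
      LinearMap.range f ≤ C b → LinearMap.range f ≤ C a := by
    intro a b hab
    induction b, hab using Nat.le_induction with
    | base => exact fun _ _ _ hf => hf
    | succ b hab ih =>
      intro hb hD f hf
      exact ih (by omega) (fun j h1 h2 => hD j h1 (by omega)) f
        (drop b (by omega) (hD b hab (by omega)) f hf)
  have hD : ∃ k < n, D k := by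
    by_contra! hcon
    obtain ⟨N, ⟨e⟩, -⟩ := hT.unique_standard_sub
    have h1 := desc 0 n (Nat.zero_le n) le_rfl (fun j _ hj => hcon j hj)
      (N.subtype ∘ₗ e.symm.toLinearMap ∘ₗ (X.standardKernel l).mkQ) (hn ▸ le_top)
    rw [h0] at h1
    refine hKtop (eq_top_iff.mpr fun y _ =>
      (Submodule.Quotient.mk_eq_zero (X.standardKernel l)).mp ?_)
    refine e.symm.injective (Subtype.ext ?_)
    rw [map_zero]
    exact h1 ⟨y, rfl⟩
  have hker : ∀ k (p : X.P l →ₗ[A] T), (∀ y, p y ∈ C k ↔ y ∈ X.standardKernel l) →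
      LinearMap.ker p = X.standardKernel l := fun k p hp =>
    le_antisymm (fun y hy => (hp y).mp (by
      rw [LinearMap.mem_ker.mp hy]
      exact (C k).zero_mem)) (hTK p)
  -- Maps from `P l` to `T` kill `standardKernel l`, so each such step embeds a copy of `Δ l` in
  -- `T`. Two steps give two different copies, contrary to uniqueness.
  have huniq : ∀ j k, j < k → D j → D k → False := by
    rintro j k hjk ⟨p, hp, hpK⟩ ⟨p', hp', hpK'⟩
    have heq := hT.unique_standard_sub.unique (X.exists_linearEquiv_of_ker_eq p (hker j p hpK))
      (X.exists_linearEquiv_of_ker_eq p' (hker k p' hpK'))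
    refine hKtop (eq_top_iff.mpr fun y _ => (hpK' y).mp ?_)
    have h1 : p' y ∈ LinearMap.range p := heq ▸ ⟨y, rfl⟩
    exact hC hjk (hp ▸ Submodule.mem_sup_right h1)
  obtain ⟨k, hk, hDk⟩ := hD
  obtain ⟨p, hp, hpK⟩ := hDk
  have hDk : D k := ⟨p, hp, hpK⟩
  refine ⟨p, fun hp0 => hKtop ?_, fun f => ?_⟩
  · rw [← hker k p hpK, hp0, LinearMap.ker_zero]
  · have hf := desc (k + 1) n hk le_rfl (fun j hj _ hDj => huniq k j hj hDk hDj) f (hn ▸ le_top)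
    obtain ⟨r, hr⟩ := Module.Projective.exists_sub_mem p f (hf.trans hp.le)
    obtain ⟨c, hc⟩ := hA.exists_sub_mem r
    have h1 := desc 0 k (Nat.zero_le k) hk.le (fun j _ hj hDj => huniq j k hj hDj hDk)
      (f - p ∘ₗ r) (by
        rintro _ ⟨y, rfl⟩
        exact hr y)
    refine ⟨c, fun y => ?_⟩
    have h2 : f y - p (r y) = 0 := (Submodule.mem_bot A).mp (h0 ▸ h1 ⟨y, rfl⟩)
    have h3 := hTK p (hc y)
    rw [LinearMap.mem_ker, map_sub, map_smul, sub_eq_zero] at h3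
    rw [← h3, sub_eq_zero.mp h2]

end Tilting

end SimpleIndexing

/-! ## Filtrations that agree up to shift on subquotients -/

section Comparison

variable {A : Type u} [Ring A]

/-- Two families of submodules induce the same family on `T₁ / T₂` up to a shift. -/
def AgreeUpToShift {T : Type*} [AddCommGroup T] [Module A T] (G₁ G₂ : ℤ → Submodule A T)
    (T₁ T₂ : Submodule A T) : Prop :=
  ∃ δ : ℤ, ∀ i, (G₁ i ⊓ T₁) ⊔ T₂ = (G₂ (i - δ) ⊓ T₁) ⊔ T₂

section

variable {T : Type*} [AddCommGroup T] [Module A T] {G₁ G₂ : ℤ → Submodule A T}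
  {T₁ T₂ : Submodule A T}

theorem AgreeUpToShift.symm (h : AgreeUpToShift G₁ G₂ T₁ T₂) : AgreeUpToShift G₂ G₁ T₁ T₂ := by
  obtain ⟨δ, h⟩ := h
  refine ⟨-δ, fun i => ?_⟩
  rw [h]
  simp

theorem AgreeUpToShift.shift (h : AgreeUpToShift G₁ G₂ T₁ T₂) (s : ℤ) :
    AgreeUpToShift G₁ (fun i => G₂ (i + s)) T₁ T₂ := by
  obtain ⟨δ, h⟩ := h
  refine ⟨δ + s, fun i => ?_⟩
  beta_reduce
  rw [h, show i - (δ + s) + s = i - δ by ring]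

theorem ZFamily.mem_subquot {F : ZFamily T} {G : Submodule A T} {i : ℤ}
    (hF : F i = G.toAddSubgroup) (z : T₁) :
    (T₂.submoduleOf T₁).mkQ z ∈ F.subquot T₁ T₂ i ↔ (z : T) ∈ (G ⊓ T₁) ⊔ T₂ := by
  constructor
  · rintro ⟨y, hy, hyz⟩
    have h1 : (T₂.submoduleOf T₁).mkQ y = (T₂.submoduleOf T₁).mkQ z := hyz
    rw [eq_comm, ← sub_eq_zero, ← map_sub] at h1
    have h2 : (z : T) - y ∈ T₂ := (Submodule.Quotient.mk_eq_zero (T₂.submoduleOf T₁)).mp h1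
    have h3 : (y : T) ∈ F i := hy
    rw [hF] at h3
    rw [← add_sub_cancel (y : T) z]
    exact Submodule.add_mem_sup ⟨h3, y.2⟩ h2
  · intro hz
    obtain ⟨a, ⟨ha, ha'⟩, b, hb, hab⟩ := Submodule.mem_sup.mp hz
    refine ⟨⟨a, ha'⟩, ?_, ?_⟩
    · change a ∈ F i
      rw [hF]
      exact ha
    · change (T₂.submoduleOf T₁).mkQ ⟨a, ha'⟩ = (T₂.submoduleOf T₁).mkQ z
      rw [eq_comm, ← sub_eq_zero, ← map_sub]
      refine (Submodule.Quotient.mk_eq_zero (T₂.submoduleOf T₁)).mpr ?_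
      change (z : T) - a ∈ T₂
      rw [← hab, add_sub_cancel_left]
      exact hb

theorem agreeUpToShift_of_subquot {F₁ F₂ : ZFamily T} (hle : T₂ ≤ T₁)
    (h₁ : ∀ i, F₁ i = (G₁ i).toAddSubgroup) (h₂ : ∀ i, F₂ i = (G₂ i).toAddSubgroup)
    (h : ∃ δ : ℤ, ∀ i, F₁.subquot T₁ T₂ i = F₂.subquot T₁ T₂ (i - δ)) :
    AgreeUpToShift G₁ G₂ T₁ T₂ := by
  obtain ⟨δ, h⟩ := h
  have hT : ∀ G : Submodule A T, (G ⊓ T₁) ⊔ T₂ ≤ T₁ := fun G => sup_le inf_le_right hle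
  refine ⟨δ, fun i => le_antisymm (fun z hz => ?_) fun z hz => ?_⟩
  · rwa [← ZFamily.mem_subquot (h₂ (i - δ)) ⟨z, hT _ hz⟩, ← h,
      ZFamily.mem_subquot (h₁ i) ⟨z, hT _ hz⟩]
  · rwa [← ZFamily.mem_subquot (h₁ i) ⟨z, hT _ hz⟩, h,
      ZFamily.mem_subquot (h₂ (i - δ)) ⟨z, hT _ hz⟩]

end

/-! ### Functoriality of the standard filtrations -/

theorem map_mem_radSeries {M N : Type*} [AddCommGroup M] [Module A M] [AddCommGroup N] [Module A N]
    (f : M →ₗ[A] N) (n : ℕ) {y : M} (hy : y ∈ radSeries A M n) : f y ∈ radSeries A N n := by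
  have h1 : (radSeries A M n).map f ≤ radSeries A N n := by
    rw [radSeries, Submodule.map_smul'']
    exact Submodule.smul_mono le_rfl le_top
  exact h1 ⟨y, hy, rfl⟩

theorem map_moduleSocle_le {M N : Type*} [AddCommGroup M] [Module A M] [AddCommGroup N]
    [Module A N] (f : M →ₗ[A] N) : (moduleSocle A M).map f ≤ moduleSocle A N := by
  rw [Submodule.map_le_iff_le_comap]
  refine sSup_le fun S hS => ?_
  have hS' : IsSimpleModule A S := hS
  rw [← Submodule.map_le_iff_le_comap]
  rcases LinearMap.injective_or_eq_zero (f ∘ₗ S.subtype) with hi | h0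
  · have h1 : S.map f = LinearMap.range (f ∘ₗ S.subtype) := by
      rw [LinearMap.range_comp, Submodule.range_subtype]
    exact le_sSup (show IsSimpleModule A (S.map f) from
      h1 ▸ IsSimpleModule.congr (LinearEquiv.ofInjective _ hi).symm)
  · rintro _ ⟨y, hy, rfl⟩
    have : f y = 0 := LinearMap.congr_fun h0 ⟨y, hy⟩
    rw [this]
    exact Submodule.zero_mem _

theorem map_mem_socSeries {M N : Type*} [AddCommGroup M] [Module A M] [AddCommGroup N]
    [Module A N] (f : M →ₗ[A] N) (n : ℕ) : socSeries A M n ≤ (socSeries A N n).comap f := by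
  induction n with
  | zero => exact bot_le
  | succ n ih =>
    intro y hy
    exact map_moduleSocle_le (Submodule.mapQ _ _ f ih) ⟨_, hy, rfl⟩

theorem socSeries_le_succ (M : Type*) [AddCommGroup M] [Module A M] (n : ℕ) :
    socSeries A M n ≤ socSeries A M (n + 1) := fun y hy => by
  change (socSeries A M n).mkQ y ∈ moduleSocle A (M ⧸ socSeries A M n)
  rw [Submodule.mkQ_apply, (Submodule.Quotient.mk_eq_zero _).mpr hy]
  exact Submodule.zero_mem _

theorem socSeries_monotone (M : Type*) [AddCommGroup M] [Module A M] : Monotone (socSeries A M) :=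
  monotone_nat_of_le_succ (socSeries_le_succ M)

/-- If the socle series stabilised at a proper submodule, a submodule covering it would be simple
modulo it and hence lie in the next term. -/
theorem exists_socSeries_eq_top (M : Type*) [AddCommGroup M] [Module A M] [IsNoetherian A M]
    [IsArtinian A M] : ∃ n, socSeries A M n = ⊤ := by
  obtain ⟨n, hn⟩ := monotone_stabilizes_iff_noetherian.mpr (inferInstance : IsNoetherian A M)
    ⟨socSeries A M, socSeries_monotone M⟩
  have h1 : socSeries A M n = socSeries A M (n + 1) := hn (n + 1) (Nat.le_succ n)
  refine ⟨n, ?_⟩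
  by_contra hne
  obtain ⟨B, hB, -⟩ := exists_covBy_le_of_lt (lt_top_iff_ne_top.mpr hne)
  have hle : B ≤ socSeries A M (n + 1) := fun z hz => by
    let S : Submodule A (M ⧸ socSeries A M n) := B.map (socSeries A M n).mkQ
    have hS : IsSimpleModule A S := by
      have hq := (covBy_iff_quot_is_simple hB.le).mp hB
      let p : B →ₗ[A] M ⧸ socSeries A M n := (socSeries A M n).mkQ ∘ₗ B.subtype
      have hk : LinearMap.ker p = (socSeries A M n).comap B.subtype := by
        rw [LinearMap.ker_comp, Submodule.ker_mkQ]
      have hr : LinearMap.range p = S := by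
        rw [LinearMap.range_comp, Submodule.range_subtype]
      rw [← hr]
      exact IsSimpleModule.congr (p.quotKerEquivRange.symm.trans (Submodule.quotEquivOfEq _ _ hk))
    exact le_sSup (show S ∈ {N : Submodule A _ | IsSimpleModule A N} from hS) ⟨z, hz, rfl⟩
  exact hB.lt.not_ge (hle.trans h1.ge)

theorem exists_radSeries_eq_bot [IsArtinianRing A] (M : Type*) [AddCommGroup M] [Module A M] :
    ∃ n, radSeries A M n = ⊥ := by
  obtain ⟨n, hn⟩ := IsSemiprimaryRing.isNilpotent (R := A)
  refine ⟨n, ?_⟩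
  rw [radSeries, hn]
  exact Submodule.bot_smul _

theorem radSeries_zero (M : Type*) [AddCommGroup M] [Module A M] : radSeries A M 0 = ⊤ := by
  rw [radSeries, Submodule.pow_zero, Ideal.one_eq_top]
  exact Submodule.top_smul _

theorem radSeries_antitone (M : Type*) [AddCommGroup M] [Module A M] :
    Antitone (radSeries A M) := fun _ _ h =>
  Submodule.smul_mono_left (Ideal.pow_le_pow_right h)

theorem map_mem_loewyFiltration (κ : LoewyKind) {M N : Type*} [AddCommGroup M] [Module A M]
    [AddCommGroup N] [Module A N] (f : M →ₗ[A] N) (i : ℤ) {y : M}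
    (hy : y ∈ loewyFiltration A κ M i) : f y ∈ loewyFiltration A κ N i := by
  cases κ with
  | radical => exact map_mem_radSeries f _ hy
  | socle => exact map_mem_socSeries f _ hy

end Comparison

namespace SimpleIndexing

variable {A : Type u} [Ring A] {Λ : Type x} {X : SimpleIndexing A Λ}

/-! ### Uniqueness up to shift of the filtrations of prescribed shape -/

section Shape

variable {E : Type*} [AddCommGroup E] [Module A E]

/-- The isomorphism between the two quotients of `P l` lifts to an endomorphism of `P l`, which
preserves the radical filtration. Only the shifts can differ. -/
theorem IsShiftedQuotient.exists_shift {l : Λ} {F₁ F₂ : ZFamily E}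
    (h₁ : X.IsShiftedQuotient l F₁) (h₂ : X.IsShiftedQuotient l F₂) :
    ∃ δ : ℤ, ∀ i, F₁ i = F₂ (i - δ) := by
  have key : ∀ (F₁ F₂ : ZFamily E) (N₁ N₂ : Submodule A (X.P l)) (s₁ s₂ : ℤ)
      (e₁ : E ≃ₗ[A] X.P l ⧸ N₁) (e₂ : E ≃ₗ[A] X.P l ⧸ N₂),
      (∀ i, (F₁ i).map e₁.toLinearMap.toAddMonoidHom =
        ((radicalFiltration A (X.P l)).quot N₁).shift s₁ i) →
      (∀ i, (F₂ i).map e₂.toLinearMap.toAddMonoidHom =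
        ((radicalFiltration A (X.P l)).quot N₂).shift s₂ i) →
      ∀ i, F₁ i ≤ F₂ (i - s₁ + s₂) := by
    intro F₁ F₂ N₁ N₂ s₁ s₂ e₁ e₂ h₁ h₂ i z hz
    obtain ⟨θ, hθ⟩ := Module.projective_lifting_property N₂.mkQ
      (e₂.toLinearMap ∘ₗ e₁.symm.toLinearMap ∘ₗ N₁.mkQ) N₂.mkQ_surjective
    have h3 : e₁ z ∈ (F₁ i).map e₁.toLinearMap.toAddMonoidHom := ⟨z, hz, rfl⟩
    rw [h₁] at h3
    obtain ⟨y, hy, hyz⟩ := h3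
    have h4 : e₂ z ∈ ((radicalFiltration A (X.P l)).quot N₂).shift s₂ (i - s₁ + s₂) := by
      refine ⟨θ y, ?_, ?_⟩
      · rw [add_sub_cancel_right]
        exact map_mem_radSeries θ _ hy
      · have h5 : N₁.mkQ y = e₁ z := hyz
        refine (LinearMap.congr_fun hθ y).trans ?_
        simp [h5]
    rw [← h₂] at h4
    obtain ⟨z', hz', hzz⟩ := h4
    rwa [← e₂.injective hzz]
  obtain ⟨N₁, s₁, e₁, h₁⟩ := h₁
  obtain ⟨N₂, s₂, e₂, h₂⟩ := h₂
  refine ⟨s₁ - s₂, fun i => le_antisymm ?_ ?_⟩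
  · have := key F₁ F₂ N₁ N₂ s₁ s₂ e₁ e₂ h₁ h₂ i
    rwa [sub_add] at this
  · have := key F₂ F₁ N₂ N₁ s₂ s₁ e₂ e₁ h₂ h₁ (i - (s₁ - s₂))
    rwa [show i - (s₁ - s₂) - s₂ + s₁ = i by ring] at this

/-- Dually, the comparison extends to an endomorphism of `I l`. Both standard filtrations are
functorial, so the convention `κ` plays no role. -/
theorem IsShiftedSubmodule.exists_shift {κ : LoewyKind} {l : Λ} {F₁ F₂ : ZFamily E}
    (h₁ : X.IsShiftedSubmodule κ l F₁) (h₂ : X.IsShiftedSubmodule κ l F₂) :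
    ∃ δ : ℤ, ∀ i, F₁ i = F₂ (i - δ) := by
  have := (X.isInjectiveHull l).1
  have key : ∀ (F₁ F₂ : ZFamily E) (N₁ N₂ : Submodule A (X.I l)) (s₁ s₂ : ℤ)
      (e₁ : E ≃ₗ[A] N₁) (e₂ : E ≃ₗ[A] N₂),
      (∀ i, (F₁ i).map e₁.toLinearMap.toAddMonoidHom =
        ((loewyFiltration A κ (X.I l)).sub N₁).shift s₁ i) →
      (∀ i, (F₂ i).map e₂.toLinearMap.toAddMonoidHom =
        ((loewyFiltration A κ (X.I l)).sub N₂).shift s₂ i) →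
      ∀ i, F₁ i ≤ F₂ (i - s₁ + s₂) := by
    intro F₁ F₂ N₁ N₂ s₁ s₂ e₁ e₂ h₁ h₂ i z hz
    obtain ⟨θ, hθ⟩ := Module.Injective.extension_property A _ _ (M := X.I l)
      (N₁.subtype ∘ₗ e₁.toLinearMap) (N₁.subtype_injective.comp e₁.injective)
      (N₂.subtype ∘ₗ e₂.toLinearMap)
    have h3 : e₁ z ∈ (F₁ i).map e₁.toLinearMap.toAddMonoidHom := ⟨z, hz, rfl⟩
    rw [h₁] at h3
    have h4 : e₂ z ∈ ((loewyFiltration A κ (X.I l)).sub N₂).shift s₂ (i - s₁ + s₂) := by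
      change (e₂ z : X.I l) ∈ loewyFiltration A κ (X.I l) (i - s₁ + s₂ - s₂)
      rw [add_sub_cancel_right]
      have h5 : θ (e₁ z) = e₂ z := LinearMap.congr_fun hθ z
      rw [← h5]
      exact map_mem_loewyFiltration κ θ _ h3
    rw [← h₂] at h4
    obtain ⟨z', hz', hzz⟩ := h4
    rwa [← e₂.injective hzz]
  obtain ⟨N₁, s₁, e₁, h₁⟩ := h₁
  obtain ⟨N₂, s₂, e₂, h₂⟩ := h₂
  refine ⟨s₁ - s₂, fun i => le_antisymm ?_ ?_⟩
  · have := key F₁ F₂ N₁ N₂ s₁ s₂ e₁ e₂ h₁ h₂ i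
    rwa [sub_add] at this
  · have := key F₂ F₁ N₂ N₁ s₂ s₁ e₂ e₁ h₂ h₁ (i - (s₁ - s₂))
    rwa [show i - (s₁ - s₂) - s₂ + s₁ = i by ring] at this

end Shape

end SimpleIndexing

theorem Int.exists_and_not_succ {p : ℤ → Prop} (hp : ∀ i j, i ≤ j → p j → p i) (h₁ : ∃ i, p i)
    (h₂ : ∃ i, ¬ p i) : ∃ i, p i ∧ ¬ p (i + 1) := by
  obtain ⟨b, hb⟩ := h₂
  obtain ⟨i, hi, hmax⟩ := Int.exists_greatest_of_bdd (P := p)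
    ⟨b, fun z hz => not_lt.mp fun hlt => hb (hp b z hlt.le hz)⟩ h₁
  exact ⟨i, hi, fun h => by have := hmax _ h; omega⟩

namespace SimpleIndexing

section Finiteness

variable {A : Type u} [Ring A] {Λ : Type x} (X : SimpleIndexing A Λ)

/-- Each simple quotient in a composition series contributes at most one weight. This yields a
maximal bad weight without assuming `Λ` finite. -/
theorem finite_setOf_hom_ne_zero (M : Type*) [AddCommGroup M] [Module A M]
    (h : IsFiniteLength A M) : {m | ∃ f : X.P m →ₗ[A] M, f ≠ 0}.Finite := by
  induction h with
  | of_subsingleton =>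
    refine Set.finite_empty.subset ?_
    rintro m ⟨f, hf⟩
    exact hf (LinearMap.ext fun _ => Subsingleton.elim _ _)
  | @of_simple_quotient M _ _ N hs _ ih =>
    obtain ⟨l, ⟨e⟩⟩ := X.exists_linearEquiv_L (M ⧸ N)
    refine (ih.union (Set.finite_singleton l)).subset ?_
    rintro m ⟨f, hf⟩
    by_cases h0 : N.mkQ ∘ₗ f = 0
    · refine Or.inl ⟨f.codRestrict N fun y =>
        (Submodule.Quotient.mk_eq_zero _).mp (LinearMap.congr_fun h0 y), fun h1 => hf ?_⟩
      ext y
      exact congrArg Subtype.val (LinearMap.congr_fun h1 y)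
    · exact Or.inr (X.eq_of_hom_ne_zero e _ h0)

end Finiteness

/-! ### Climbing the weight order -/

section Steps

variable {A : Type u} [Ring A] {Λ : Type x} {X : SimpleIndexing A Λ}
variable {T : Type w} [AddCommGroup T] [Module A T] {G₁ G₂ : ℤ → Submodule A T}

/-- If `G₁` is ahead of `G₂` on `T₁ / T₂`, then some map from `P m` detects this on a simple
subquotient `R / S ≅ L m` of `T₁ / T₂`. -/
theorem exists_hom_of_simple_subquotient (hG₁ : Antitone G₁) (htop : ∃ i, G₁ i = ⊤)
    (hbot : ∃ i, G₁ i = ⊥) {T₁ T₂ R S : Submodule A T} (hTS : T₂ ≤ S) (hSR : S ≤ R) (hRT : R ≤ T₁)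
    {δ : ℤ} (hδ : 0 < δ) (hG : ∀ i, (G₁ i ⊓ T₁) ⊔ T₂ = (G₂ (i - δ) ⊓ T₁) ⊔ T₂)
    {m : Λ} (e : (R ⧸ S.submoduleOf R) ≃ₗ[A] X.L m) :
    ∃ i, ∃ f : X.P m →ₗ[A] T, LinearMap.range f ≤ G₁ i ∧ ¬ LinearMap.range f ≤ G₂ i := by
  have : IsSimpleModule A (R ⧸ S.submoduleOf R) := IsSimpleModule.congr e
  have hne : ¬ R ≤ S := fun h => (isSimpleModule_iff_isCoatom.mp this).1
    (Submodule.comap_subtype_eq_top.mpr h)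
  -- `i` is the degree of the simple subquotient `R / S` for `G₁`.
  obtain ⟨i, hi, hi'⟩ := Int.exists_and_not_succ (p := fun i => ¬ G₁ i ⊓ R ≤ S)
    (fun i j hij hj h => hj ((inf_le_inf_right R (hG₁ hij)).trans h))
    (by
      obtain ⟨i, hi⟩ := htop
      exact ⟨i, by rwa [hi, top_inf_eq]⟩)
    (by
      obtain ⟨i, hi⟩ := hbot
      exact ⟨i, by simp [hi]⟩)
  rw [not_not] at hi'
  -- Modulo `T₂`, `G₂ i` is `G₁ (i + δ)`, and `δ > 0` pushes this beyond the degree of `R / S`.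
  have hi₂ : G₂ i ⊓ R ≤ S := fun z hz => by
    have h1 : z ∈ (G₁ (i + δ) ⊓ T₁) ⊔ T₂ := by
      rw [hG, add_sub_cancel_right]
      exact Submodule.mem_sup_left ⟨hz.1, hRT hz.2⟩
    obtain ⟨a, ha, b, hb, rfl⟩ := Submodule.mem_sup.mp h1
    have haR : a ∈ R := by
      have := R.sub_mem hz.2 (hSR (hTS hb))
      rwa [add_sub_cancel_right] at this
    exact S.add_mem (hi' ⟨hG₁ (by omega) ha.1, haR⟩) (hTS hb)
  let g : (G₁ i ⊓ R : Submodule A T) →ₗ[A] R ⧸ S.submoduleOf R :=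
    (S.submoduleOf R).mkQ ∘ₗ Submodule.inclusion inf_le_right
  have hg : g ≠ 0 := fun h0 => hi fun z hz =>
    (Submodule.Quotient.mk_eq_zero (S.submoduleOf R)).mp (LinearMap.congr_fun h0 ⟨z, hz⟩)
  obtain ⟨f, hf⟩ := X.exists_hom_comp_ne_zero e g hg
  refine ⟨i, Submodule.subtype _ ∘ₗ f, ?_, fun hle => ?_⟩
  · rintro _ ⟨y, rfl⟩
    exact (f y).2.1
  · have h1 : g ∘ₗ f = 0 := by
      ext y
      exact (Submodule.Quotient.mk_eq_zero (S.submoduleOf R)).mpr (hi₂ ⟨hle ⟨y, rfl⟩, (f y).2.2⟩)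
    have := IsSimpleModule.nontrivial A (R ⧸ S.submoduleOf R)
    obtain ⟨z, hz⟩ := exists_ne (0 : R ⧸ S.submoduleOf R)
    obtain ⟨y, rfl⟩ := X.symm_comp_cover_surjective e z
    exact hz (by rw [← hf, h1, LinearMap.zero_apply])

/-- A map `P l → T` that is not into `G` is detected by a map `T / G → I l`. -/
theorem exists_hom_comp_eq {l : Λ} {f : X.P l →ₗ[A] T} {G : Submodule A T}
    (hf : ¬ LinearMap.range f ≤ G) :
    ∃ h : T →ₗ[A] X.I l, h ∘ₗ f = X.hull l ∘ₗ X.cover l ∧ G ≤ LinearMap.ker h := by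
  have := (X.isInjectiveHull l).1
  let f' := G.mkQ ∘ₗ f
  have hf' : f' ≠ 0 := fun h0 => hf <| by
    rintro _ ⟨y, rfl⟩
    exact (Submodule.Quotient.mk_eq_zero _).mp (LinearMap.congr_fun h0 y)
  obtain ⟨g, hg⟩ := LinearMap.exists_comp_eq_of_ker_le f'.rangeRestrict f'.surjective_rangeRestrict
    (X.hull l ∘ₗ X.cover l) (by
      rw [LinearMap.ker_rangeRestrict]
      refine (X.ker_le_ker_cover hf').trans fun y hy => ?_
      rw [LinearMap.mem_ker, LinearMap.comp_apply, LinearMap.mem_ker.mp hy, map_zero])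
  obtain ⟨h, hh⟩ := Module.Injective.extension_property A _ _ (M := X.I l)
    (LinearMap.range f').subtype (Submodule.subtype_injective _) g
  refine ⟨h ∘ₗ G.mkQ, ?_, fun y hy => ?_⟩
  · rw [← hg, ← hh]
    rfl
  · rw [LinearMap.mem_ker, LinearMap.comp_apply, Submodule.mkQ_apply,
      (Submodule.Quotient.mk_eq_zero _).mpr hy, map_zero]

variable [PartialOrder Λ]

/-- Modulo the image of `standardKernel l`, the range of `f` is a quotient of `Δ l`. The extension
cannot split because `L l` is the only simple quotient of `P l`, and `l ≠ m`. -/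
theorem isWeylIrreducible_of_range {l m : Λ} (hlm : l < m) (f : X.P l →ₗ[A] T)
    {S : Submodule A T} (hS : S ≤ (X.standardKernel l).map f)
    (e : ((X.standardKernel l).map f ⧸ S.submoduleOf ((X.standardKernel l).map f)) ≃ₗ[A] X.L m) :
    X.IsWeylIrreducible l m (LinearMap.range f ⧸ S.submoduleOf (LinearMap.range f)) := by
  set R := (X.standardKernel l).map f
  set T₁ := LinearMap.range f
  have hRT : R ≤ T₁ := LinearMap.map_le_range
  let t : X.P l →ₗ[A] T₁ ⧸ S.submoduleOf T₁ := (S.submoduleOf T₁).mkQ ∘ₗ f.rangeRestrict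
  have ht : Function.Surjective t := (Submodule.mkQ_surjective _).comp f.surjective_rangeRestrict
  let N : Submodule A (X.Standard l) :=
    (X.standardKernel l ⊔ LinearMap.ker f).map (X.standardKernel l).mkQ
  let s : X.P l →ₗ[A] X.Standard l ⧸ N := N.mkQ ∘ₗ (X.standardKernel l).mkQ
  have hs : Function.Surjective s := (Submodule.mkQ_surjective _).comp (Submodule.mkQ_surjective _)
  have hsk : ∀ y, s y = 0 ↔ f y ∈ R := fun y => by
    have h1 : s y = 0 ↔ y ∈ N.comap (X.standardKernel l).mkQ :=
      Submodule.Quotient.mk_eq_zero N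
    rw [h1, Submodule.comap_map_mkQ, ← sup_assoc, sup_idem, ← Submodule.comap_map_eq]
    rfl
  have htk : ∀ y, t y = 0 ↔ f y ∈ S := fun y =>
    Submodule.Quotient.mk_eq_zero (S.submoduleOf T₁)
  obtain ⟨g, hg⟩ := LinearMap.exists_comp_eq_of_ker_le t ht s fun y hy =>
    (hsk y).mpr (hS ((htk y).mp hy))
  have hgt : ∀ y, g (t y) = s y := LinearMap.congr_fun hg
  let i : R ⧸ S.submoduleOf R →ₗ[A] T₁ ⧸ S.submoduleOf T₁ :=
    Submodule.mapQ _ _ (Submodule.inclusion hRT) le_rfl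
  have hi : Function.Injective i := by
    rw [← LinearMap.ker_eq_bot, LinearMap.ker_eq_bot']
    intro z
    obtain ⟨z, rfl⟩ := Submodule.mkQ_surjective _ z
    intro hz
    exact (Submodule.Quotient.mk_eq_zero (S.submoduleOf R)).mpr
      ((Submodule.Quotient.mk_eq_zero (S.submoduleOf T₁)).mp hz)
  have hrange : LinearMap.range i = LinearMap.ker g := by
    ext z
    constructor
    · rintro ⟨z, rfl⟩
      obtain ⟨⟨_, y, hy, rfl⟩, rfl⟩ := Submodule.mkQ_surjective _ z
      exact (hgt y).trans ((hsk y).mpr ⟨y, hy, rfl⟩)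
    · intro hz
      obtain ⟨y, rfl⟩ := ht z
      exact ⟨Submodule.Quotient.mk ⟨f y, (hsk y).mp ((hgt y).symm.trans hz)⟩, rfl⟩
  refine ⟨hlm, N, i ∘ₗ e.symm.toLinearMap, g, hi.comp e.symm.injective, ?_, ?_, ?_⟩
  · intro z
    obtain ⟨y, rfl⟩ := hs z
    exact ⟨t y, hgt y⟩
  · rw [LinearMap.range_comp, LinearEquiv.range, Submodule.map_top, hrange]
  · rintro ⟨σ, hσ⟩
    have hσ' : ∀ z, g (σ z) = z := LinearMap.congr_fun hσ
    have hd : ∀ y, (t - σ ∘ₗ g ∘ₗ t) y ∈ LinearMap.range i := fun y => by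
      rw [hrange, LinearMap.mem_ker]
      simp [hσ']
    have h0 : (t - σ ∘ₗ g ∘ₗ t).codRestrict _ hd = 0 := by
      by_contra hne
      exact hlm.ne (X.eq_of_hom_ne_zero ((LinearEquiv.ofInjective i hi).symm.trans e) _ hne)
    have htσ : ∀ z, z = σ (g z) := fun z => by
      obtain ⟨y, rfl⟩ := ht z
      exact sub_eq_zero.mp (congrArg Subtype.val (LinearMap.congr_fun h0 y))
    have := IsSimpleModule.nontrivial A (X.L m)
    obtain ⟨z, hz⟩ := exists_ne (0 : X.L m)
    refine hz (e.symm.injective (hi ?_))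
    have h1 : i (e.symm z) ∈ LinearMap.ker g := hrange ▸ ⟨_, rfl⟩
    rw [map_zero, map_zero, htσ (i (e.symm z)), LinearMap.mem_ker.mp h1, map_zero]

/-- Climbing the weight order using Weyl-irreducible subquotients. -/
theorem exists_lt_of_weylIrreducible
    (hK : ∀ l, HasModuleFiltration A (fun m => X.Standard m) {m | l < m} (X.standardKernel l))
    [IsNoetherian A T]
    (hG₁ : Antitone G₁) (hG₂ : Antitone G₂) (htop : ∃ i, G₁ i = ⊤) (hbot : ∃ i, G₁ i = ⊥)
    (hW : ∀ T₁ T₂ : Submodule A T, T₂ ≤ T₁ → ∀ l m,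
      X.IsWeylIrreducible l m (T₁ ⧸ T₂.submoduleOf T₁) → AgreeUpToShift G₁ G₂ T₁ T₂)
    {l : Λ} {d : ℤ} {f : X.P l →ₗ[A] T} (hf₁ : LinearMap.range f ≤ G₁ d)
    (hf₂ : ¬ LinearMap.range f ≤ G₂ d) (hfK : ¬ X.standardKernel l ≤ LinearMap.ker f) :
    ∃ m, l < m ∧ ∃ i, ∃ f : X.P m →ₗ[A] T,
      LinearMap.range f ≤ G₁ i ∧ ¬ LinearMap.range f ≤ G₂ i := by
  set R := (X.standardKernel l).map f with hR
  have hRbot : (⊥ : Submodule A R) ≠ ⊤ := fun h => hfK fun y hy => by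
    have h1 : (⟨f y, y, hy, rfl⟩ : R) ∈ (⊥ : Submodule A R) := h ▸ trivial
    exact congrArg Subtype.val ((Submodule.mem_bot A).mp h1)
  -- A simple quotient of the image of `standardKernel l` is hit by a standard factor of weight
  -- above `l`, so its own weight is above `l`.
  obtain ⟨Q, hQ, -⟩ := (eq_top_or_exists_le_coatom (⊥ : Submodule A R)).resolve_left hRbot
  let S : Submodule A T := Q.map R.subtype
  have hSR : S ≤ R := Submodule.map_subtype_le R Q
  have hSQ : S.submoduleOf R = Q := Submodule.comap_map_eq_of_injective R.subtype_injective Q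
  have hsimple : IsSimpleModule A (R ⧸ S.submoduleOf R) :=
    isSimpleModule_iff_isCoatom.mpr (hSQ ▸ hQ)
  obtain ⟨m, ⟨e⟩⟩ := X.exists_linearEquiv_L (R ⧸ S.submoduleOf R)
  let g : X.standardKernel l →ₗ[A] R ⧸ S.submoduleOf R :=
    (S.submoduleOf R).mkQ ∘ₗ (f ∘ₗ Submodule.subtype _).codRestrict R fun y => ⟨y, y.2, rfl⟩
  have hg : g ≠ 0 := fun h0 => hQ.1 <| by
    rw [← hSQ, eq_top_iff]
    rintro ⟨_, y, hy, rfl⟩ -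
    exact (Submodule.Quotient.mk_eq_zero (S.submoduleOf R)).mp (LinearMap.congr_fun h0 ⟨y, hy⟩)
  obtain ⟨m', hm', f', hf'⟩ := exists_hom_comp_ne_zero_of_standardFiltration (hK l) hg
  have hlm : l < m := X.eq_of_hom_ne_zero e _ hf' ▸ hm'
  have hRT : R ≤ LinearMap.range f := LinearMap.map_le_range
  obtain ⟨δ, hδ⟩ := hW _ _ (hSR.trans hRT) l m (isWeylIrreducible_of_range hlm f hSR e)
  refine ⟨m, hlm, exists_hom_of_simple_subquotient hG₁ htop hbot le_rfl hSR hRT ?_ hδ e⟩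
  -- If `δ ≤ 0`, then `f` maps `P l` into `G₂ d` plus the image of `standardKernel l`. So `P l` is
  -- the sum of the preimage of `G₂ d` and `standardKernel l`, both inside its maximal submodule.
  by_contra! hδ0
  have h1 := hδ d
  rw [inf_eq_right.mpr hf₁, sup_eq_left.mpr (hSR.trans hRT)] at h1
  have hne : (G₂ d).comap f ≠ ⊤ := fun h => hf₂ (by
    rintro _ ⟨y, rfl⟩
    exact (h ▸ trivial : y ∈ (G₂ d).comap f))
  refine (X.isCoatom_ker_cover l).1 (eq_top_iff.mpr fun y _ => ?_)
  have h2 : f y ∈ (G₂ (d - δ) ⊓ LinearMap.range f) ⊔ S := h1 ▸ ⟨y, rfl⟩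
  obtain ⟨a, ha, b, hb, hab⟩ := Submodule.mem_sup.mp h2
  obtain ⟨k, hk, rfl⟩ := hSR hb
  have h3 : y - k ∈ (G₂ d).comap f := by
    rw [Submodule.mem_comap, map_sub, ← hab, add_sub_cancel_right]
    exact hG₂ (by omega) ha.1
  have := Submodule.add_mem _ (X.le_ker_cover hne h3) (X.standardKernel_le_ker_cover l hk)
  rwa [sub_add_cancel] at this

/-- `h` embeds `R / ker h` in `I l`, with the part inside `∇ l` as kernel of the map to `L m`. A
splitting would give a non-zero submodule of `I l` meeting `∇ l` trivially, but every non-zero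
submodule contains the socle `L l`. -/
theorem isIrreducibleGood_of_ker {l m : Λ} (hlm : l < m) (h : T →ₗ[A] X.I l)
    {R : Submodule A T} (hR : (X.costandard l).comap h ≤ R)
    (e : (R ⧸ ((X.costandard l).comap h).submoduleOf R) ≃ₗ[A] X.L m) :
    X.IsIrreducibleGood l m (R ⧸ (LinearMap.ker h).submoduleOf R) := by
  set U := (X.costandard l).comap h
  have hkU : LinearMap.ker h ≤ U := fun y hy => by
    change h y ∈ X.costandard l
    rw [LinearMap.mem_ker.mp hy]
    exact Submodule.zero_mem _
  have hkk : (LinearMap.ker h).submoduleOf R = LinearMap.ker (h ∘ₗ R.subtype) :=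
    (LinearMap.ker_comp _ _).symm
  let k : R ⧸ (LinearMap.ker h).submoduleOf R →ₗ[A] X.I l :=
    Submodule.liftQ _ (h ∘ₗ R.subtype) hkk.le
  have hk : Function.Injective k := LinearMap.ker_eq_bot.mp (Submodule.ker_liftQ_eq_bot _ _ _ hkk.ge)
  let V : Submodule A (X.costandard l) := (U.map h).submoduleOf (X.costandard l)
  have hV : ∀ v : V, ((v : X.costandard l) : X.I l) ∈ LinearMap.range k := fun v => by
    obtain ⟨y, hy, hyv⟩ := v.2
    exact ⟨Submodule.Quotient.mk ⟨y, hR hy⟩, hyv⟩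
  let j : V →ₗ[A] R ⧸ (LinearMap.ker h).submoduleOf R :=
    (LinearEquiv.ofInjective k hk).symm.toLinearMap ∘ₗ
      (Submodule.subtype _ ∘ₗ Submodule.subtype _).codRestrict _ hV
  have hkj : ∀ v : V, k (j v) = ((v : X.costandard l) : X.I l) := fun v =>
    congrArg Subtype.val ((LinearEquiv.ofInjective k hk).apply_symm_apply ⟨_, hV v⟩)
  let g : R ⧸ (LinearMap.ker h).submoduleOf R →ₗ[A] X.L m :=
    e.toLinearMap ∘ₗ Submodule.factor (Submodule.comap_mono hkU)
  have hgk : ∀ z, g z = 0 ↔ k z ∈ X.costandard l := fun z => by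
    obtain ⟨z, rfl⟩ := Submodule.mkQ_surjective _ z
    exact (e.map_eq_zero_iff).trans (Submodule.Quotient.mk_eq_zero (U.submoduleOf R))
  refine ⟨hlm, V, j, g, fun v v' hv => ?_, ?_, ?_, ?_⟩
  · have h1 := congrArg k hv
    rw [hkj, hkj] at h1
    exact Subtype.ext (Subtype.ext h1)
  · exact e.surjective.comp (Submodule.factor_surjective _)
  · ext z
    rw [LinearMap.mem_ker, hgk]
    constructor
    · rintro ⟨v, rfl⟩
      rw [hkj]
      exact v.1.2
    · intro hz
      obtain ⟨y, rfl⟩ := Submodule.mkQ_surjective _ z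
      refine ⟨⟨⟨_, hz⟩, (y : T), hz, rfl⟩, hk ?_⟩
      rw [hkj]
  · rintro ⟨σ, hσ⟩
    have hσ' : ∀ z, g (σ z) = z := LinearMap.congr_fun hσ
    have hle := X.range_hull_le (N := LinearMap.range (k ∘ₗ σ)) fun h0 => by
      have := IsSimpleModule.nontrivial A (X.L m)
      obtain ⟨z, hz⟩ := exists_ne (0 : X.L m)
      have h1 : k (σ z) = 0 := LinearMap.congr_fun (LinearMap.range_eq_bot.mp h0) z
      apply hz
      rw [← hσ' z, hk (h1.trans k.map_zero.symm), map_zero]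
    apply X.hull_comp_cover_ne_zero l
    ext y
    obtain ⟨z, hz⟩ := hle ⟨X.cover l y, rfl⟩
    have hz' : k (σ z) = X.hull l (X.cover l y) := hz
    have h1 : g (σ z) = 0 := (hgk _).mpr (hz' ▸ X.range_hull_le_costandard l ⟨_, rfl⟩)
    rw [hσ'] at h1
    rw [LinearMap.comp_apply, ← hz', h1, map_zero, map_zero]
    rfl

/-- Climbing the weight order using irreducible-good subquotients. -/
theorem exists_lt_of_irreducibleGood
    (hK : ∀ l, HasModuleFiltration A (fun m => X.Standard m) {m | l < m} (X.standardKernel l))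
    [IsArtinian A T]
    (hG₁ : Antitone G₁) (hG₂ : Antitone G₂) (htop : ∃ i, G₁ i = ⊤) (hbot : ∃ i, G₁ i = ⊥)
    (hI : ∀ T₁ T₂ : Submodule A T, T₂ ≤ T₁ → ∀ l m,
      X.IsIrreducibleGood l m (T₁ ⧸ T₂.submoduleOf T₁) → AgreeUpToShift G₁ G₂ T₁ T₂)
    {l : Λ} {d : ℤ} {f : X.P l →ₗ[A] T} (hf₁ : LinearMap.range f ≤ G₁ d)
    {h : T →ₗ[A] X.I l} (hhf : h ∘ₗ f = X.hull l ∘ₗ X.cover l) (hhG : G₂ d ≤ LinearMap.ker h)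
    (hh : ¬ LinearMap.range h ≤ X.costandard l) :
    ∃ m, l < m ∧ ∃ i, ∃ f : X.P m →ₗ[A] T,
      LinearMap.range f ≤ G₁ i ∧ ¬ LinearMap.range f ≤ G₂ i := by
  set U := (X.costandard l).comap h with hU
  have hUtop : U ≠ ⊤ := fun h0 => hh <| by
    rintro _ ⟨y, rfl⟩
    exact (h0 ▸ trivial : y ∈ U)
  obtain ⟨R, hUR, -⟩ := exists_covBy_le_of_lt (lt_top_iff_ne_top.mpr hUtop)
  have hsimple : IsSimpleModule A (R ⧸ U.submoduleOf R) :=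
    (covBy_iff_quot_is_simple hUR.le).mp hUR
  obtain ⟨m, ⟨e⟩⟩ := X.exists_linearEquiv_L (R ⧸ U.submoduleOf R)
  obtain ⟨q, hq⟩ := X.exists_hom_comp_ne_zero e (U.submoduleOf R).mkQ (fun h0 =>
    (isSimpleModule_iff_isCoatom.mp hsimple).1 (by rw [← Submodule.ker_mkQ (U.submoduleOf R), h0,
      LinearMap.ker_zero]))
  have hqU : ∀ y, h (q y) ∈ X.costandard l ↔ y ∈ LinearMap.ker (X.cover m) := fun y => by
    have h1 : (U.submoduleOf R).mkQ (q y) = e.symm (X.cover m y) := LinearMap.congr_fun hq y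
    rw [LinearMap.mem_ker, ← e.symm.map_eq_zero_iff, ← h1]
    exact (Submodule.Quotient.mk_eq_zero (U.submoduleOf R)).symm
  -- The lift `P m → R → I l` leaves `∇ l` but sends `standardKernel m` into it.
  have hlm : l < m := by
    refine lt_of_not_range_le_costandard hK (h ∘ₗ R.subtype ∘ₗ q) (fun hle => ?_) fun y hy =>
      (hqU y).mpr (X.standardKernel_le_ker_cover m hy)
    exact (X.isCoatom_ker_cover m).1 (eq_top_iff.mpr fun y _ => (hqU y).mp (hle ⟨y, rfl⟩))
  have hkU : LinearMap.ker h ≤ U := fun y hy => by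
    change h y ∈ X.costandard l
    rw [LinearMap.mem_ker.mp hy]
    exact Submodule.zero_mem _
  obtain ⟨δ, hδ⟩ := hI R _ (hkU.trans hUR.le) l m (isIrreducibleGood_of_ker hlm h hUR.le e)
  refine ⟨m, hlm, exists_hom_of_simple_subquotient hG₁ htop hbot hkU hUR.le le_rfl ?_ hδ e⟩
  -- If `δ ≤ 0`, then `G₁ d ⊓ R` lies in `G₂ d` plus `ker h`, which is `ker h`; so `h ∘ f` would
  -- vanish.
  by_contra! hδ0
  apply X.hull_comp_cover_ne_zero l
  rw [← hhf]
  ext y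
  have hfU : f y ∈ U := by
    change h (f y) ∈ X.costandard l
    have h1 : h (f y) = X.hull l (X.cover l y) := LinearMap.congr_fun hhf y
    rw [h1]
    exact X.range_hull_le_costandard l ⟨_, rfl⟩
  have h1 : f y ∈ (G₁ d ⊓ R) ⊔ LinearMap.ker h :=
    Submodule.mem_sup_left ⟨hf₁ ⟨y, rfl⟩, hUR.le hfU⟩
  rw [hδ] at h1
  exact sup_le (inf_le_left.trans ((hG₂ (by omega)).trans hhG)) le_rfl h1

end Steps

/-! ### Comparing two filtrations of a tilting module -/

section Main

variable {K : Type v} {A : Type u} [Field K] [Ring A] [Algebra K A]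
variable {Λ : Type x} [PartialOrder Λ] {X : SimpleIndexing A Λ}
variable {T : Type w} [AddCommGroup T] [Module A T] {G₁ G₂ : ℤ → Submodule A T}

/-- Two filtrations of a tilting module that agree up to shift on all Weyl-irreducible and
irreducible-good subquotients can be compared at the highest weight. -/
theorem IsIndecomposableTilting.filtration_le [IsNoetherian A T] [IsArtinian A T]
    (hA : X.IsQuasiHereditary K) {l : Λ} (hT : X.IsIndecomposableTilting l T)
    (hG₁ : Antitone G₁) (hG₂ : Antitone G₂) (htop : ∃ i, G₁ i = ⊤) (hbot : ∃ i, G₁ i = ⊥)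
    (hW : ∀ T₁ T₂ : Submodule A T, T₂ ≤ T₁ → ∀ l m,
      X.IsWeylIrreducible l m (T₁ ⧸ T₂.submoduleOf T₁) → AgreeUpToShift G₁ G₂ T₁ T₂)
    (hI : ∀ T₁ T₂ : Submodule A T, T₂ ≤ T₁ → ∀ l m,
      X.IsIrreducibleGood l m (T₁ ⧸ T₂.submoduleOf T₁) → AgreeUpToShift G₁ G₂ T₁ T₂)
    (hl : ∀ d, ∀ f : X.P l →ₗ[A] T, LinearMap.range f ≤ G₁ d → LinearMap.range f ≤ G₂ d) (d : ℤ) :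
    G₁ d ≤ G₂ d := by
  by_contra hd
  let B : Set Λ := {m | ∃ i, ∃ f : X.P m →ₗ[A] T,
    LinearMap.range f ≤ G₁ i ∧ ¬ LinearMap.range f ≤ G₂ i}
  have hBfin : B.Finite := by
    refine (X.finite_setOf_hom_ne_zero T
      (isFiniteLength_iff_isNoetherian_isArtinian.mpr ⟨inferInstance, inferInstance⟩)).subset ?_
    rintro m ⟨i, f, -, hf⟩
    refine ⟨f, fun h0 => hf ?_⟩
    rw [h0, LinearMap.range_zero]
    exact bot_le
  have hBne : B.Nonempty := by
    obtain ⟨m, f, h1, h2⟩ := X.exists_range_le_not_le hd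
    exact ⟨m, d, f, h1, h2⟩
  obtain ⟨m, ⟨i, f, hf₁, hf₂⟩, hmax⟩ := hBfin.exists_maximal hBne
  have hno : ¬ ∃ m', m < m' ∧ m' ∈ B := fun ⟨m', hlt, hm'⟩ => hlt.not_ge (hmax hm' hlt.le)
  by_cases hfK : X.standardKernel m ≤ LinearMap.ker f
  · obtain ⟨h, hhf, hhG⟩ := exists_hom_comp_eq hf₂
    by_cases hh : LinearMap.range h ≤ X.costandard m
    · obtain rfl := hT.eq_of_comp_ne_zero hA f h hfK hh hhf
      exact hf₂ (hl i f hf₁)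
    · exact hno (exists_lt_of_irreducibleGood hA.filtration hG₁ hG₂ htop hbot hI hf₁ hhf hhG hh)
  · exact hno (exists_lt_of_weylIrreducible hA.filtration hG₁ hG₂ htop hbot hW hf₁ hf₂ hfK)

/-- Two filtrations of a tilting module that agree up to shift on all Weyl-irreducible and
irreducible-good subquotients agree up to shift. -/
theorem IsIndecomposableTilting.filtration_eq_shift [IsNoetherian A T] [IsArtinian A T]
    (hA : X.IsQuasiHereditary K) {l : Λ} (hT : X.IsIndecomposableTilting l T)
    (hG₁ : Antitone G₁) (hG₂ : Antitone G₂) (htop₁ : ∃ i, G₁ i = ⊤) (hbot₁ : ∃ i, G₁ i = ⊥)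
    (htop₂ : ∃ i, G₂ i = ⊤) (hbot₂ : ∃ i, G₂ i = ⊥)
    (hW : ∀ T₁ T₂ : Submodule A T, T₂ ≤ T₁ → ∀ l m,
      X.IsWeylIrreducible l m (T₁ ⧸ T₂.submoduleOf T₁) → AgreeUpToShift G₁ G₂ T₁ T₂)
    (hI : ∀ T₁ T₂ : Submodule A T, T₂ ≤ T₁ → ∀ l m,
      X.IsIrreducibleGood l m (T₁ ⧸ T₂.submoduleOf T₁) → AgreeUpToShift G₁ G₂ T₁ T₂) :
    ∃ s : ℤ, ∀ i, G₁ i = G₂ (i + s) := by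
  obtain ⟨p, hp0, hp⟩ := hT.exists_forall_eq_smul hA
  have hdeg : ∀ G : ℤ → Submodule A T, Antitone G → (∃ i, G i = ⊤) → (∃ i, G i = ⊥) →
      ∃ a, ∀ i, LinearMap.range p ≤ G i ↔ i ≤ a := by
    intro G hG ⟨t, ht⟩ ⟨b, hb⟩
    obtain ⟨a, ha, ha'⟩ := Int.exists_and_not_succ (p := fun i => LinearMap.range p ≤ G i)
      (fun i j hij hj => hj.trans (hG hij)) ⟨t, ht ▸ le_top⟩
      ⟨b, fun h => hp0 (LinearMap.range_eq_bot.mp (le_bot_iff.mp (hb ▸ h)))⟩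
    exact ⟨a, fun i => ⟨fun h => not_lt.mp fun hlt => ha' (h.trans (hG hlt)),
      fun h => ha.trans (hG h)⟩⟩
  have hcomp : ∀ (G G' : ℤ → Submodule A T),
      (∀ i, LinearMap.range p ≤ G i → LinearMap.range p ≤ G' i) →
      ∀ d, ∀ f : X.P l →ₗ[A] T, LinearMap.range f ≤ G d → LinearMap.range f ≤ G' d := by
    intro G G' hGG' d f hf
    obtain ⟨c, hc⟩ := hp f
    by_cases hc0 : c = 0
    · rintro _ ⟨y, rfl⟩
      rw [hc, hc0, map_zero, zero_smul]
      exact Submodule.zero_mem _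
    · have h1 : LinearMap.range p ≤ G d := by
        rintro _ ⟨y, rfl⟩
        have h2 : p y = algebraMap K A c⁻¹ • f y := by
          rw [hc, smul_smul, ← map_mul, inv_mul_cancel₀ hc0, map_one, one_smul]
        rw [h2]
        exact Submodule.smul_mem _ _ (hf ⟨y, rfl⟩)
      rintro _ ⟨y, rfl⟩
      rw [hc]
      exact Submodule.smul_mem _ _ (hGG' d h1 ⟨y, rfl⟩)
  obtain ⟨a₁, ha₁⟩ := hdeg G₁ hG₁ htop₁ hbot₁
  obtain ⟨a₂, ha₂⟩ := hdeg G₂ hG₂ htop₂ hbot₂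
  have hpiff : ∀ i, LinearMap.range p ≤ G₁ i ↔ LinearMap.range p ≤ G₂ (i + (a₂ - a₁)) :=
    fun i => by
      rw [ha₁, ha₂]
      omega
  have hanti : Antitone fun i => G₂ (i + (a₂ - a₁)) := fun i j hij => hG₂ (by omega)
  -- This shift puts the generator `p` of `Hom(P l, T)` in the same degree for both filtrations, so
  -- the hypothesis at the highest weight holds both ways.
  refine ⟨a₂ - a₁, fun i => le_antisymm ?_ ?_⟩
  · exact hT.filtration_le hA hG₁ hanti htop₁ hbot₁
      (fun T₁ T₂ h l m hE => (hW T₁ T₂ h l m hE).shift _)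
      (fun T₁ T₂ h l m hE => (hI T₁ T₂ h l m hE).shift _)
      (hcomp _ _ fun i => (hpiff i).mp) i
  · refine hT.filtration_le (G₁ := fun i => G₂ (i + (a₂ - a₁))) hA hanti hG₁ ?_ ?_
      (fun T₁ T₂ h l m hE => ((hW T₁ T₂ h l m hE).shift _).symm)
      (fun T₁ T₂ h l m hE => ((hI T₁ T₂ h l m hE).shift _).symm)
      (hcomp _ _ fun i => (hpiff i).mpr) i
    · obtain ⟨t, ht⟩ := htop₂
      exact ⟨t - (a₂ - a₁), by simpa using ht⟩
    · obtain ⟨t, ht⟩ := hbot₂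
      exact ⟨t - (a₂ - a₁), by simpa using ht⟩

end Main

end SimpleIndexing

theorem mainTheorem2 {K : Type v} {A : Type u} [Field K] [Ring A] [Algebra K A]
    [FiniteDimensional K A] {Λ : Type x} [PartialOrder Λ] (X : SimpleIndexing A Λ)
    (hA : X.IsQuasiHereditary K)
    (hRees : IsGradedQuasiHereditary K (AlgFiltration.radical K A).reesGrading Λ)
    {T : Type w} [AddCommGroup T] [Module A T] (l : Λ) (hT : X.IsIndecomposableTilting l T)
    (κ : LoewyKind)
    (hrad : X.NoStretchedSubquotients κ (radicalFiltration A T))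
    (hsoc : X.NoStretchedSubquotients κ (socleFiltration A T)) :
    IsRigidModule A T := by
  have hArt : IsArtinianRing A := IsArtinianRing.of_finite K A
  have hfin : Module.Finite A T :=
    SimpleIndexing.finite_of_standardFiltration hT.standard_filtration
  have hnoeth : IsNoetherian A T := inferInstance
  have hart : IsArtinian A T := inferInstance
  obtain ⟨r, hr⟩ := exists_radSeries_eq_bot (A := A) T
  obtain ⟨t, ht⟩ := exists_socSeries_eq_top (A := A) T
  have h0 := radSeries_zero (A := A) T
  obtain ⟨s, hs⟩ := hT.filtration_eq_shift hA
    (G₁ := fun i => radSeries A T i.toNat) (G₂ := fun i => socSeries A T (-i).toNat)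
    (fun i j hij => radSeries_antitone T (by omega))
    (fun i j hij => socSeries_monotone T (by omega))
    ⟨0, h0⟩ ⟨r, by simpa using hr⟩
    ⟨-t, by simpa using ht⟩ ⟨0, rfl⟩
    (fun T₁ T₂ hle l m hE => agreeUpToShift_of_subquot hle (fun _ => rfl) (fun _ => rfl)
      (((hrad T₁ T₂ hle l m).1 hE).exists_shift ((hsoc T₁ T₂ hle l m).1 hE)))
    (fun T₁ T₂ hle l m hE => agreeUpToShift_of_subquot hle (fun _ => rfl) (fun _ => rfl)
      (((hrad T₁ T₂ hle l m).2 hE).exists_shift ((hsoc T₁ T₂ hle l m).2 hE)))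
  -- A positive shift would equate `rad⁰ T = T` with `soc⁰ T = 0`.
  have hneg : s ≤ 0 := by
    by_contra! hpos
    have h1 := hs 0
    beta_reduce at h1
    rw [Int.toNat_zero, h0, show (-(0 + s)).toNat = 0 by omega] at h1
    have := hT.indecomposable.1
    exact top_ne_bot h1
  -- Socle terms sit in negated degrees, so degree `i + s` is the term of index `-s - i`; hence the
  -- length is `-s`.
  refine ⟨(-s).toNat, fun i hi => ?_⟩
  have h1 := hs i
  beta_reduce at h1
  rwa [Int.toNat_natCast, show (-((i : ℤ) + s)).toNat = (-s).toNat - i by omega] at h1
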